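/- **Theorem 1.3.** Let $\mathbb T$ be a tree with vertex set $V$, and for $x\in V$ let $N(x)$ be the set of its neighbours. The *minus biased vote process* on $\mathbb T$ with noise $\epsilon\in(0,1)$, started from all plus, is the process $\sigma(t)\in\{-1,1\}^V$, $t=0,1,2,\dots$, with $\sigma_x(0)=1$ for all $x\in V$ in which, at each time $t\ge 1$ and at each vertex $x\in V$, independently over all $t$ and $x$, - with probability $1-\epsilon$, the spin $\sigma_x(t)$ is set to $-1$ if $|\{y\in N(x):\sigma_y(t-1)=-1\}|\ge 2$, and to $1$ otherwise; - with probability $\epsilon$, the spin $\sigma_x(t)$ is set to $-1$ or $1$ with probability $\tfrac12$ each. For every integer $d\ge 3$ there are constants $\epsilon_0>0$ and $0<c<\tfrac12$, depending only on $d$, such that the following holds. For every infinite tree $\mathbb T$ of maximal degree at most $d$ and every noise $\epsilon\in(0,1)$ with $\epsilon<\epsilon_0$, the minus biased vote process on $\mathbb T$ with noise $\epsilon$, started from all plus, satisfies $$\mathbb P(\sigma_v(t)=-1)\le c\qquad\text{for all vertices } v \text{ of } \mathbb T \text{ and all times } t\ge 0.$$ -/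

import Mathlib

open MeasureTheory

/-- The two spin values. -/
inductive Spin where
  | minus
  | plus

/-- The update that occurs at one vertex at one time: either a minus bias update, or a noise
update, which carries the new spin. -/
inductive Update where
  | bias
  | noise (s : Spin)

instance : MeasurableSpace Update := ⊤

/-- The law of a single update with noise `ε`: a minus bias update with probability `1 - ε`, and
a noise update with probability `ε`, whose new spin is `-1` or `1` with probability half each. -/
noncomputable def updateLaw (ε : Set.Ioo (0 : ℝ) 1) : Measure Update :=
  ENNReal.ofReal (1 - (ε : ℝ)) • Measure.dirac Update.bias
    + ENNReal.ofReal ((ε : ℝ) / 2) • Measure.dirac (Update.noise Spin.minus)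
    + ENNReal.ofReal ((ε : ℝ) / 2) • Measure.dirac (Update.noise Spin.plus)

instance (ε : Set.Ioo (0 : ℝ) 1) : IsProbabilityMeasure (updateLaw ε) := by
  constructor
  have h0 : (0 : ℝ) < ε := ε.2.1
  have h1 : (ε : ℝ) < 1 := ε.2.2
  simp only [updateLaw, Measure.add_apply, Measure.smul_apply, measure_univ, smul_eq_mul, mul_one]
  rw [← ENNReal.ofReal_add (by linarith) (by linarith),
    ← ENNReal.ofReal_add (by linarith) (by linarith)]
  rw [show 1 - (ε : ℝ) + ε / 2 + ε / 2 = 1 by ring, ENNReal.ofReal_one]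

/-- The probability measure `ℙ` of the process with noise `ε` on the vertex set `V`: the updates
`ω (t, x)`, at all times `t` and all vertices `x`, are independent with law `updateLaw ε`. -/
noncomputable def updateMeasure (V : Type*) (ε : Set.Ioo (0 : ℝ) 1) :
    Measure (ℕ × V → Update) :=
  Measure.infinitePi fun _ => updateLaw ε

instance (V : Type*) (ε : Set.Ioo (0 : ℝ) 1) : IsProbabilityMeasure (updateMeasure V ε) := by
  unfold updateMeasure
  infer_instance

open Classical in
/-- The spin of `x` after the update `u`, if the configuration before it is `σ`: a minus bias
update sets it to `-1` if at least two neighbours of `x` have spin `-1`, and to `1` otherwise. -/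
noncomputable def applyUpdate {V : Type*} (G : SimpleGraph V) (σ : V → Spin) (x : V) :
    Update → Spin
  | Update.bias => if 2 ≤ {y | G.Adj x y ∧ σ y = Spin.minus}.encard then Spin.minus else Spin.plus
  | Update.noise s => s

/-- The minus biased vote process on `G` started from all plus: the configuration at time `t`,
as a function of the updates `ω`. The update that leads from time `t` to time `t + 1` at the
vertex `x` is `ω (t + 1, x)`. -/
noncomputable def minusBiasedVote {V : Type*} (G : SimpleGraph V) (ω : ℕ × V → Update) :
    ℕ → V → Spin
  | 0 => fun _ => Spin.plus
  | t + 1 => fun x => applyUpdate G (minusBiasedVote G ω t) x (ω (t + 1, x))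

/-!
Only noise updates to `-1`, the *defects*, can create minus spins, so it suffices to find, for the
event that `v` has spin `-1` at time `t`, a family of finite sets of defects, one of which must be
present, such that `∑ ε ^ #F` over the family is small. This is `IsCovered`. Such covers add under
unions and multiply under intersections of events that concern disjoint parts of the tree.

The family is found by recursion along the tree. Fix a vertex `y` with a neighbour `x`, its parent,
and let `x` have spin `-1` at an arbitrary set `R` of times. Consider the maximal runs of times, in
steps of two, at which `y` has spin `-1`. Each such time is explained by a defect at `y`, or by a
child of `y` with spin `-1` one step before, so a run of `y` is covered by a *chain* of defects and
of runs of children. The claim (`runsCovered`) is that the event that given runs occur at `y` is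
covered with weight `∏ runWeight θ m` over the lengths `m` of the runs, where
`runWeight θ m = θ * (θ / 100) ^ m / m ^ 2` and `θ` is of order `1 / d`. Three facts make the
induction work.

* The sequence `1 / m ^ 2` is stable under convolution, so that splitting a run into the runs of
  several children costs only a constant factor, which the prefactor `θ` of each run pays for
  (`sum_runWeight_mul_runWeight_le`).
* The remaining case is a chain that consists of a single run of one of the at most `d` children.
  At the start of the run of `y`, that child is not helped by `y`, because `y` did not have spin `-1`
  two steps before. It is then explained by a defect or by two of its own children. Such runs are
  flagged, and they have an extra factor `θ` that pays for the choice of the child. Conversely, the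
  explanations of a flagged run are never a plain partition into runs of children: they contain a
  defect, an overlap or an additional run (`IsWindow.marked_chain`), and these are rare
  (`IsChainWeight.isCovered_marked`).
* Different runs of `y` are explained by different runs of children. Just after a run of `y` ends,
  its parent has spin `-1` while `y` does not acquire it, so at that time no child has spin `-1`, and
  no run of a child reaches from one run of `y` to the next. This property of the ends of runs is
  inherited by the runs of the children (`IsRun.isWindow`).

The requests for different children are independent since they concern disjoint components of the
tree (`isCovered_satisfied`), and the induction is over the time horizon.
-/

/-! ### Weighted covers -/

/-- `IsCovered w U A β`: there is a finite family of finite subsets of `U`, of total weight at most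
`β`, such that every configuration `S ∈ A` contains a member of the family. The weight of a finite
set is the product of the weights `w` of its points. -/
def IsCovered {P : Type*} (w : P → ℝ) (U : Set P) (A : Set (Set P)) (β : ℝ) : Prop :=
  ∃ 𝓕 : Finset (Finset P), (∀ F ∈ 𝓕, (F : Set P) ⊆ U) ∧ ∑ F ∈ 𝓕, ∏ p ∈ F, w p ≤ β ∧
    ∀ S ∈ A, ∃ F ∈ 𝓕, (F : Set P) ⊆ S

namespace IsCovered

variable {P : Type*} {w : P → ℝ} {U W : Set P} {A B : Set (Set P)} {α β : ℝ}

theorem mono (h : IsCovered w U A α) (hU : U ⊆ W) (hA : B ⊆ A) (hβ : α ≤ β) :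
    IsCovered w W B β := by
  obtain ⟨𝓕, h1, h2, h3⟩ := h
  exact ⟨𝓕, fun F hF => (h1 F hF).trans hU, h2.trans hβ, fun S hS => h3 S (hA hS)⟩

theorem of_isEmpty (hA : ∀ S, S ∉ A) (hβ : 0 ≤ β) : IsCovered w U A β :=
  ⟨∅, by simp, by simpa using hβ, fun S hS => (hA S hS).elim⟩

theorem one (A : Set (Set P)) : IsCovered w ∅ A 1 :=
  ⟨{∅}, by simp, by simp, fun S _ => ⟨∅, by simp⟩⟩

theorem finset (F : Finset P) : IsCovered w F {S | (F : Set P) ⊆ S} (∏ p ∈ F, w p) :=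
  ⟨{F}, by simp, by simp, fun S hS => ⟨F, by simpa using hS⟩⟩

theorem singleton (p : P) : IsCovered w {p} {S | p ∈ S} (w p) := by
  simpa using finset (w := w) {p}

theorem union (hw : ∀ p, 0 ≤ w p) (hA : IsCovered w U A α) (hB : IsCovered w U B β) :
    IsCovered w U (A ∪ B) (α + β) := by
  classical
  obtain ⟨𝓕, h1, h2, h3⟩ := hA
  obtain ⟨𝓖, g1, g2, g3⟩ := hB
  refine ⟨𝓕 ∪ 𝓖, ?_, ?_, ?_⟩
  · intro F hF
    rcases Finset.mem_union.1 hF with h | h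
    exacts [h1 F h, g1 F h]
  · have h := Finset.sum_union_inter (s₁ := 𝓕) (s₂ := 𝓖) (f := fun F => ∏ p ∈ F, w p)
    have h0 : 0 ≤ ∑ F ∈ 𝓕 ∩ 𝓖, ∏ p ∈ F, w p :=
      Finset.sum_nonneg fun F _ => Finset.prod_nonneg fun p _ => hw p
    linarith
  · rintro S (hS | hS)
    · obtain ⟨F, hF, hFS⟩ := h3 S hS
      exact ⟨F, Finset.mem_union_left _ hF, hFS⟩
    · obtain ⟨F, hF, hFS⟩ := g3 S hS
      exact ⟨F, Finset.mem_union_right _ hF, hFS⟩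

theorem biUnion {ι : Type*} (hw : ∀ p, 0 ≤ w p) (s : Finset ι) {A : ι → Set (Set P)} {β : ι → ℝ}
    (h : ∀ i ∈ s, IsCovered w U (A i) (β i)) :
    IsCovered w U {S | ∃ i ∈ s, S ∈ A i} (∑ i ∈ s, β i) := by
  classical
  induction s using Finset.induction_on with
  | empty => exact of_isEmpty (by simp) (by simp)
  | insert i s hi ih =>
    rw [Finset.sum_insert hi]
    refine ((h i (by simp)).union hw (ih fun j hj => h j (by simp [hj]))).mono subset_rfl ?_ le_rfl
    intro S hS
    simpa using hS

theorem inter (hw : ∀ p, 0 ≤ w p) (hA : IsCovered w U A α) (hB : IsCovered w W B β)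
    (hUW : Disjoint U W) : IsCovered w (U ∪ W) (A ∩ B) (α * β) := by
  classical
  obtain ⟨𝓕, h1, h2, h3⟩ := hA
  obtain ⟨𝓖, g1, g2, g3⟩ := hB
  have nn : ∀ F : Finset P, 0 ≤ ∏ p ∈ F, w p := fun F => Finset.prod_nonneg fun p _ => hw p
  refine ⟨(𝓕 ×ˢ 𝓖).image fun q => q.1 ∪ q.2, ?_, ?_, ?_⟩
  · intro F hF
    obtain ⟨⟨X, Y⟩, hXY, rfl⟩ := Finset.mem_image.1 hF
    rw [Finset.mem_product] at hXY
    rw [Finset.coe_union]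
    exact Set.union_subset_union (h1 _ hXY.1) (g1 _ hXY.2)
  · calc ∑ F ∈ (𝓕 ×ˢ 𝓖).image fun q => q.1 ∪ q.2, ∏ p ∈ F, w p
        ≤ ∑ q ∈ 𝓕 ×ˢ 𝓖, ∏ p ∈ q.1 ∪ q.2, w p :=
          Finset.sum_image_le_of_nonneg (fun _ _ => nn _)
      _ = ∑ q ∈ 𝓕 ×ˢ 𝓖, (∏ p ∈ q.1, w p) * ∏ p ∈ q.2, w p := by
          refine Finset.sum_congr rfl fun q hq => ?_
          rw [Finset.mem_product] at hq
          refine Finset.prod_union ?_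
          rw [← Finset.disjoint_coe]
          exact hUW.mono (h1 _ hq.1) (g1 _ hq.2)
      _ = (∑ F ∈ 𝓕, ∏ p ∈ F, w p) * ∑ F ∈ 𝓖, ∏ p ∈ F, w p := by
          rw [Finset.sum_mul_sum, Finset.sum_product]
      _ ≤ α * β := mul_le_mul h2 g2 (Finset.sum_nonneg fun F _ => nn F)
          ((Finset.sum_nonneg fun F _ => nn F).trans h2)
  · rintro S ⟨hSA, hSB⟩
    obtain ⟨F, hF, hFS⟩ := h3 S hSA
    obtain ⟨F', hF', hFS'⟩ := g3 S hSB
    refine ⟨F ∪ F', Finset.mem_image.2 ⟨(F, F'), Finset.mem_product.2 ⟨hF, hF'⟩, rfl⟩, ?_⟩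
    rw [Finset.coe_union]
    exact Set.union_subset hFS hFS'

theorem biInter {ι : Type*} (hw : ∀ p, 0 ≤ w p) (s : Finset ι) {U : ι → Set P}
    {A : ι → Set (Set P)} {β : ι → ℝ} (h : ∀ i ∈ s, IsCovered w (U i) (A i) (β i))
    (hU : (s : Set ι).PairwiseDisjoint U) :
    IsCovered w (⋃ i ∈ s, U i) {S | ∀ i ∈ s, S ∈ A i} (∏ i ∈ s, β i) := by
  classical
  induction s using Finset.induction_on with
  | empty => simpa using one (w := w) _
  | insert i s hi ih =>
    rw [Finset.prod_insert hi]
    have ih' := ih (fun j hj => h j (by simp [hj])) (hU.subset (by simp))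
    refine ((h i (by simp)).inter hw ih' ?_).mono ?_ ?_ le_rfl
    · rw [Set.disjoint_iUnion₂_right]
      intro j hj
      exact hU (by simp) (by simp [hj]) (by rintro rfl; exact hi hj)
    · simp
    · intro S hS
      exact ⟨hS i (by simp), fun j hj => hS j (by simp [hj])⟩

/-- Substitution of covers. Suppose that `A` is covered by finite sets `F`, and that for each `F` the
configurations `T` for which some `Φ T M` contains `F` are covered with the weight of `F`. Then the
configurations `T` for which some `Φ T M` is in `A` are covered with the weight of the cover
of `A`. -/
theorem bind {Q ι : Type*} {w' : Q → ℝ} {W : Set Q} (hw' : ∀ p, 0 ≤ w' p)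
    (h : IsCovered w U A β) (Φ : Set Q → ι → Set P)
    (hF : ∀ F : Finset P, IsCovered w' W {T | ∃ M, (F : Set P) ⊆ Φ T M} (∏ p ∈ F, w p)) :
    IsCovered w' W {T | ∃ M, Φ T M ∈ A} β := by
  obtain ⟨𝓕, -, h2, h3⟩ := h
  refine (biUnion hw' 𝓕 fun F _ => hF F).mono subset_rfl ?_ h2
  rintro T ⟨M, hM⟩
  obtain ⟨F, hF, hFM⟩ := h3 _ hM
  exact ⟨F, hF, M, hFM⟩

end IsCovered

/-! ### Runs and chains of runs -/

/-- Going back from a time `t ∈ M` in steps of two, there is a first time that is not in `M`. -/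
theorem exists_backward_run {M : Set ℕ} {t : ℕ} (ht : t ∈ M) :
    ∃ L, 1 ≤ L ∧ (∀ i < L, 2 * i ≤ t ∧ t - 2 * i ∈ M) ∧ (2 * L ≤ t → t - 2 * L ∉ M) := by
  classical
  have hex : ∃ L, ¬ (2 * L ≤ t ∧ t - 2 * L ∈ M) := ⟨t + 1, by omega⟩
  refine ⟨Nat.find hex, ?_, fun i hi => not_not.1 (Nat.find_min hex hi), fun h h' =>
    Nat.find_spec hex ⟨h, h'⟩⟩
  rw [Nat.one_le_iff_ne_zero]
  intro h
  have := Nat.find_spec hex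
  rw [h] at this
  exact this ⟨by omega, by simpa using ht⟩

/-- Going forward from the time `p₀ + 2 * k ∈ M` in steps of two, either there is a first time that
is not in `M`, or the last position `m - 1` is reached. -/
theorem exists_forward_run {M : Set ℕ} {p₀ k m : ℕ} (hk : k < m) (ht : p₀ + 2 * k ∈ M) :
    ∃ j, k + j < m ∧ (∀ i ≤ j, p₀ + 2 * (k + i) ∈ M) ∧
      (k + j + 1 = m ∨ p₀ + 2 * (k + j) + 2 ∉ M) := by
  induction hn : m - k generalizing k with
  | zero => omega
  | succ n ih =>
    by_cases hlast : k + 1 = m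
    · refine ⟨0, by omega, fun i hi => ?_, Or.inl (by omega)⟩
      obtain rfl : i = 0 := by omega
      simpa using ht
    by_cases hnext : p₀ + 2 * (k + 1) ∈ M
    · obtain ⟨j, h1, h2, h3⟩ := ih (k := k + 1) (by omega) hnext (by omega)
      refine ⟨j + 1, by omega, fun i hi => ?_, ?_⟩
      · rcases Nat.eq_zero_or_pos i with rfl | hi0
        · simpa using ht
        · have := h2 (i - 1) (by omega)
          rwa [show k + 1 + (i - 1) = k + i by omega] at this
      · rcases h3 with h | h
        · left; omega
        · right
          rwa [show k + (j + 1) = k + 1 + j by omega]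
    · refine ⟨0, by omega, fun i hi => ?_, Or.inr ?_⟩
      · obtain rfl : i = 0 := by omega
        simpa using ht
      · rwa [show p₀ + 2 * (k + 0) + 2 = p₀ + 2 * (k + 1) by omega]

/-- What the spin `-1` of a vertex at the times of one run can be traced back to: `Sum.inl s` is a
defect at the vertex at time `s`, and `Sum.inr (z, e, l)` is a run of the child `z` that consists of
the `l` times `e, e - 2, …`. -/
abbrev Request (V : Type*) := ℕ ⊕ (V × (ℕ × ℕ))

section Chains

variable {V : Type*} (N : Finset V) (H p₀ m : ℕ)

/-- A request in addition to a chain in which `z` covers the position `f`: a defect there, or a run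
of another child that contains `f`. -/
def ExtraRequest (S : Set (Request V)) (f : ℕ) (z : V) : Prop :=
  Sum.inl (p₀ + 1 + 2 * f) ∈ S ∨ ∃ z' ∈ N, z' ≠ z ∧ ∃ i ≤ H, ∃ j ≤ H, f + j < m ∧
    Sum.inr (z', p₀ + 2 * (f + j), 1 + i + j) ∈ S

/-- `Chain N H p₀ m f S b k`: the set `S` of requests contains a chain that covers the positions
`0, …, k` of a window of length `m`; the position `i` stands for the time `p₀ + 1 + 2 * i` of the
vertex, and for the time `p₀ + 2 * i` of its children. A chain is unmarked (`b = false`) if it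
partitions the positions into runs of children, of which only the earliest may start before the
window. It is marked (`b = true`) if it has a defect, or a run that ends `j + 1` positions after the
place where the next run starts, or an additional request at the position `f`. -/
inductive Chain (f : ℕ) (S : Set (Request V)) : Bool → ℕ → Prop
  | step {b : Bool} {z : V} {k' k : ℕ} (hz : z ∈ N) (hk' : k' < k) (hk : k < m)
      (h : Sum.inr (z, p₀ + 2 * k, k - k') ∈ S) (hc : Chain f S b k') : Chain f S b k
  | last {z : V} {k i : ℕ} (hz : z ∈ N) (hi : i ≤ H) (hk : k < m)
      (h : Sum.inr (z, p₀ + 2 * k, k + 1 + i) ∈ S) : Chain f S false k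
  | defect {b : Bool} {k : ℕ} (hk : k + 1 < m) (h : Sum.inl (p₀ + 1 + 2 * (k + 1)) ∈ S)
      (hc : Chain f S b k) : Chain f S true (k + 1)
  | defect_last (hk : 0 < m) (h : Sum.inl (p₀ + 1) ∈ S) : Chain f S true 0
  | overlap {b : Bool} {z : V} {k' k j : ℕ} (hz : z ∈ N) (hk' : k' < k) (hj : j ≤ H)
      (hk : k + (j + 1) < m)
      (h : Sum.inr (z, p₀ + 2 * (k + (j + 1)), k - k' + (j + 1)) ∈ S)
      (hc : Chain f S b k') : Chain f S true k
  | overlap_last {z : V} {k i j : ℕ} (hz : z ∈ N) (hi : i ≤ H) (hj : j ≤ H)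
      (hk : k + (j + 1) < m)
      (h : Sum.inr (z, p₀ + 2 * (k + (j + 1)), k + 1 + i + (j + 1)) ∈ S) : Chain f S true k
  | extra {z : V} {k' k : ℕ} (hz : z ∈ N) (hk' : k' < f) (hf : f ≤ k) (hk : k < m)
      (h : Sum.inr (z, p₀ + 2 * k, k - k') ∈ S) (he : ExtraRequest N H p₀ m S f z)
      (hc : Chain f S false k') : Chain f S true k
  | extra_last {z : V} {k i : ℕ} (hz : z ∈ N) (hi : i ≤ H) (hf : f ≤ k) (hk : k < m)
      (h : Sum.inr (z, p₀ + 2 * k, k + 1 + i) ∈ S) (he : ExtraRequest N H p₀ m S f z) :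
      Chain f S true k

/-- The set `S` of requests describes a window of the positions `0, …, m - 1`, in which the vertex
has defects at the times in `D` and the child `z` has spin `-1` at the times in `M z`: every
position is explained by a defect or a child, and `S` has all defects and all maximal runs that
end in the window (runs are cut at the last position). -/
structure IsWindow (D : Set ℕ) (M : V → Set ℕ) (S : Set (Request V)) : Prop where
  le : p₀ + 2 * m ≤ H + 2
  cover : ∀ k < m, p₀ + 1 + 2 * k ∈ D ∨ ∃ z ∈ N, p₀ + 2 * k ∈ M z
  defect : ∀ s ∈ D, Sum.inl s ∈ S
  run : ∀ z ∈ N, ∀ κ < m, ∀ l, 1 ≤ l →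
    (∀ i < l, 2 * i ≤ p₀ + 2 * κ ∧ p₀ + 2 * κ - 2 * i ∈ M z) →
    (2 * l ≤ p₀ + 2 * κ → p₀ + 2 * κ - 2 * l ∉ M z) →
    (κ + 1 = m ∨ p₀ + 2 * κ + 2 ∉ M z) → Sum.inr (z, p₀ + 2 * κ, l) ∈ S

variable {N H p₀ m}
variable {D : Set ℕ} {M : V → Set ℕ} {S : Set (Request V)}

namespace IsWindow

theorem exists_run (hW : IsWindow N H p₀ m D M S) {z : V} (hz : z ∈ N) {k : ℕ} (hk : k < m)
    (hM : p₀ + 2 * k ∈ M z) :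
    ∃ i j, i ≤ H ∧ j ≤ H ∧ k + j < m ∧ Sum.inr (z, p₀ + 2 * (k + j), 1 + i + j) ∈ S := by
  obtain ⟨L, hL, hL1, hL2⟩ := exists_backward_run hM
  obtain ⟨j, hj, hj1, hj2⟩ := exists_forward_run hk hM
  have hle := hW.le
  have hb := (hL1 (L - 1) (by omega)).1
  refine ⟨L - 1, j, by omega, by omega, hj, ?_⟩
  refine hW.run z hz (k + j) hj _ (by omega) (fun i hi => ⟨?_, ?_⟩) (fun h => ?_) hj2
  · rcases le_or_gt i j with h | h
    · omega
    · have := (hL1 (i - j) (by omega)).1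
      omega
  · rcases le_or_gt i j with h | h
    · have := hj1 (j - i) (by omega)
      rwa [show p₀ + 2 * (k + j) - 2 * i = p₀ + 2 * (k + (j - i)) by omega]
    · have := (hL1 (i - j) (by omega)).2
      rwa [show p₀ + 2 * (k + j) - 2 * i = p₀ + 2 * k - 2 * (i - j) by omega]
  · have := hL2 (by omega)
    rwa [show p₀ + 2 * (k + j) - 2 * (1 + (L - 1) + j) = p₀ + 2 * k - 2 * L by omega]

theorem exists_chain (hW : IsWindow N H p₀ m D M S) (f k : ℕ) (hk : k < m) :
    ∃ b, Chain N H p₀ m f S b k := by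
  induction k using Nat.strong_induction_on with
  | _ k ih =>
  by_cases hc : ∃ z ∈ N, p₀ + 2 * k ∈ M z
  · obtain ⟨z, hz, hM⟩ := hc
    obtain ⟨i, j, hi, hj, hkj, h⟩ := hW.exists_run hz hk hM
    rcases lt_or_ge i k with hik | hik
    · obtain ⟨b, hrest⟩ := ih (k - (i + 1)) (by omega) (by omega)
      rcases j with - | j
      · rw [show 1 + i + 0 = k - (k - (i + 1)) by omega] at h
        exact ⟨b, .step hz (by omega) hk h hrest⟩
      · rw [show 1 + i + (j + 1) = k - (k - (i + 1)) + (j + 1) by omega] at h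
        exact ⟨true, .overlap hz (by omega) (by omega) hkj h hrest⟩
    · rcases j with - | j
      · rw [show 1 + i + 0 = k + 1 + (i - k) by omega] at h
        exact ⟨false, .last hz (by omega) hk h⟩
      · rw [show 1 + i + (j + 1) = k + 1 + (i - k) + (j + 1) by omega] at h
        exact ⟨true, .overlap_last hz (by omega) (by omega) hkj h⟩
  · have h := hW.defect _ ((hW.cover k hk).resolve_right hc)
    rcases k with - | k
    · exact ⟨true, .defect_last hk h⟩
    · obtain ⟨b, hrest⟩ := ih k (by omega) (by omega)
      exact ⟨true, .defect hk h hrest⟩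

/-- If the position `f` is explained by a defect or by two different children, then there is a
chain that is not clean. -/
theorem marked_chain (hW : IsWindow N H p₀ m D M S) {f : ℕ} (hfm : f < m)
    (hf : p₀ + 1 + 2 * f ∈ D ∨ ∃ z ∈ N, ∃ z' ∈ N, z ≠ z' ∧ p₀ + 2 * f ∈ M z ∧ p₀ + 2 * f ∈ M z')
    (k : ℕ) (hfk : f ≤ k) (hk : k < m) : Chain N H p₀ m f S true k := by
  have hextra (z : V) : ExtraRequest N H p₀ m S f z := by
    rcases hf with h | ⟨z₁, hz₁, z₂, hz₂, hne, h₁, h₂⟩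
    · exact Or.inl (hW.defect _ h)
    · obtain ⟨z', hz', hzz', h'⟩ : ∃ z' ∈ N, z' ≠ z ∧ p₀ + 2 * f ∈ M z' := by
        by_cases h : z₁ = z
        · exact ⟨z₂, hz₂, fun h2 => hne (h.trans h2.symm), h₂⟩
        · exact ⟨z₁, hz₁, h, h₁⟩
      obtain ⟨i, j, hi, hj, hkj, h⟩ := hW.exists_run hz' hfm h'
      exact Or.inr ⟨z', hz', hzz', i, hi, j, hj, hkj, h⟩
  induction k using Nat.strong_induction_on with
  | _ k ih =>
  by_cases hc : ∃ z ∈ N, p₀ + 2 * k ∈ M z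
  · obtain ⟨z, hz, hM⟩ := hc
    obtain ⟨i, j, hi, hj, hkj, h⟩ := hW.exists_run hz hk hM
    rcases lt_or_ge i k with hik | hik
    · obtain ⟨b, hrest⟩ := hW.exists_chain f (k - (i + 1)) (by omega)
      rcases j with - | j
      · rw [show 1 + i + 0 = k - (k - (i + 1)) by omega] at h
        rcases le_or_gt f (k - (i + 1)) with hfr | hfr
        · exact .step hz (by omega) hk h (ih _ (by omega) hfr (by omega))
        · cases b with
          | false => exact .extra hz hfr hfk hk h (hextra z) hrest
          | true => exact .step hz (by omega) hk h hrest
      · rw [show 1 + i + (j + 1) = k - (k - (i + 1)) + (j + 1) by omega] at h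
        exact .overlap hz (by omega) (by omega) hkj h hrest
    · rcases j with - | j
      · rw [show 1 + i + 0 = k + 1 + (i - k) by omega] at h
        exact .extra_last hz (by omega) hfk hk h (hextra z)
      · rw [show 1 + i + (j + 1) = k + 1 + (i - k) + (j + 1) by omega] at h
        exact .overlap_last hz (by omega) (by omega) hkj h
  · have h := hW.defect _ ((hW.cover k hk).resolve_right hc)
    rcases k with - | k
    · exact .defect_last hk h
    · obtain ⟨b, hrest⟩ := hW.exists_chain f k (by omega)
      exact .defect hk h hrest

end IsWindow

end Chains

theorem IsCovered.inter_mem {P : Type*} {w : P → ℝ} {U W : Set P} {A : Set (Set P)} {β γ : ℝ}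
    (hw : ∀ p, 0 ≤ w p) (h : IsCovered w U A β) (hβ : 0 ≤ β) {c : P} (hc : c ∉ U) (hcW : c ∈ W)
    (hU : U ⊆ W) (hγ : w c ≤ γ) : IsCovered w W {S | c ∈ S ∧ S ∈ A} (γ * β) :=
  ((IsCovered.singleton c).inter hw h (by simpa using hc)).mono
    (Set.union_subset (by simpa using hcW) hU) (fun _ hS => hS)
    (mul_le_mul_of_nonneg_right hγ hβ)

theorem IsCovered.mem {P : Type*} {w : P → ℝ} {W : Set P} {γ : ℝ} {c : P} (hcW : c ∈ W)
    (hγ : w c ≤ γ) : IsCovered w W {S | c ∈ S} γ :=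
  (IsCovered.singleton c).mono (by simpa using hcW) subset_rfl hγ

/-! ### The weight of a run -/

/-- The weight of a run of length `n`. The factor `1 / n ^ 2` makes the weights stable under
convolution, see `sum_runWeight_mul_runWeight_le`. -/
noncomputable def runWeight (θ : ℝ) (n : ℕ) : ℝ := θ * (θ / 100) ^ n / (n : ℝ) ^ 2

section RunWeight

variable {θ : ℝ}

theorem runWeight_nonneg (h0 : 0 ≤ θ) (n : ℕ) : 0 ≤ runWeight θ n := by
  unfold runWeight; positivity

theorem runWeight_add_le (h0 : 0 ≤ θ) {n : ℕ} (hn : 1 ≤ n) (i : ℕ) :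
    runWeight θ (n + i) ≤ (θ / 100) ^ i * runWeight θ n := by
  unfold runWeight
  rw [pow_add]
  have hn' : (0 : ℝ) < n := by exact_mod_cast hn
  have : θ * ((θ / 100) ^ n * (θ / 100) ^ i) / ((n + i : ℕ) : ℝ) ^ 2
      ≤ θ * ((θ / 100) ^ n * (θ / 100) ^ i) / (n : ℝ) ^ 2 := by
    gcongr
    omega
  refine this.trans (le_of_eq ?_)
  ring

theorem sum_pow_le_two (h0 : 0 ≤ θ) (h1 : θ ≤ 1) (H : ℕ) :
    ∑ i ∈ Finset.range (H + 1), (θ / 100) ^ i ≤ 2 := by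
  have hlt : θ / 100 < 1 := by linarith
  have h := (hasSum_geometric_of_lt_one (by positivity) hlt)
  refine (sum_le_hasSum _ (fun i _ => by positivity) h).trans ?_
  rw [inv_le_comm₀ (by linarith) (by norm_num)]
  linarith

theorem sum_runWeight_add_le (h0 : 0 ≤ θ) (h1 : θ ≤ 1) {n : ℕ} (hn : 1 ≤ n) (H : ℕ) :
    ∑ i ∈ Finset.range (H + 1), runWeight θ (n + i) ≤ 2 * runWeight θ n := by
  calc _ ≤ ∑ i ∈ Finset.range (H + 1), (θ / 100) ^ i * runWeight θ n :=
        Finset.sum_le_sum fun i _ => runWeight_add_le h0 hn i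
    _ = (∑ i ∈ Finset.range (H + 1), (θ / 100) ^ i) * runWeight θ n := by rw [Finset.sum_mul]
    _ ≤ _ := mul_le_mul_of_nonneg_right (sum_pow_le_two h0 h1 H) (runWeight_nonneg h0 n)

theorem sum_runWeight_add_succ_le (h0 : 0 ≤ θ) (h1 : θ ≤ 1) {n : ℕ} (hn : 1 ≤ n) (H : ℕ) :
    ∑ j ∈ Finset.range (H + 1), runWeight θ (n + (j + 1)) ≤ θ / 50 * runWeight θ n := by
  have h := sum_runWeight_add_le h0 h1 (n := n + 1) (by omega) H
  have h' := runWeight_add_le h0 hn 1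
  have hcongr : ∑ j ∈ Finset.range (H + 1), runWeight θ (n + (j + 1))
      = ∑ j ∈ Finset.range (H + 1), runWeight θ (n + 1 + j) :=
    Finset.sum_congr rfl fun j _ => by rw [show n + (j + 1) = n + 1 + j by omega]
  rw [pow_one] at h'
  rw [hcongr]
  linarith

theorem sum_inv_sq_le_two (k : ℕ) : ∑ i ∈ Finset.range k, 1 / ((i : ℝ) + 1) ^ 2 ≤ 2 := by
  have key (n : ℕ) : ∑ i ∈ Finset.range (n + 1), 1 / ((i : ℝ) + 1) ^ 2 ≤ 2 - 1 / ((n : ℝ) + 1) := by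
    induction n with
    | zero => norm_num
    | succ n ih =>
      rw [Finset.sum_range_succ]
      push_cast
      have h : 1 / ((n : ℝ) + 1 + 1) ^ 2 ≤ 1 / ((n : ℝ) + 1) - 1 / ((n : ℝ) + 1 + 1) := by
        rw [div_sub_div _ _ (by positivity) (by positivity),
          div_le_div_iff₀ (by positivity) (by positivity)]
        nlinarith [(Nat.cast_nonneg n : (0 : ℝ) ≤ n)]
      linarith
  have h := key k
  have h0 : (0 : ℝ) ≤ 1 / ((k : ℝ) + 1) := by positivity
  have h1 : (0 : ℝ) ≤ 1 / ((k : ℝ) + 1) ^ 2 := by positivity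
  rw [Finset.sum_range_succ] at h
  linarith

theorem sum_runWeight_mul_runWeight_le (h0 : 0 ≤ θ) (k : ℕ) :
    ∑ k' ∈ Finset.range k, runWeight θ (k - k') * runWeight θ (k' + 1)
      ≤ 8 * θ * runWeight θ (k + 1) := by
  have term : ∀ k' ∈ Finset.range k, runWeight θ (k - k') * runWeight θ (k' + 1) ≤
      2 * θ * runWeight θ (k + 1) *
        (1 / (((k - 1 - k' : ℕ) : ℝ) + 1) ^ 2 + 1 / ((k' : ℝ) + 1) ^ 2) := by
    intro k' hk'
    rw [Finset.mem_range] at hk'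
    obtain ⟨l, rfl⟩ : ∃ l, k = k' + l + 1 := ⟨k - k' - 1, by omega⟩
    rw [show k' + l + 1 - k' = l + 1 by omega, show k' + l + 1 - 1 - k' = l by omega]
    unfold runWeight
    rw [show k' + l + 1 + 1 = (l + 1) + (k' + 1) by omega, pow_add _ (l + 1)]
    push_cast
    set x : ℝ := (l : ℝ) + 1
    set y : ℝ := (k' : ℝ) + 1
    have hx : 0 < x := by positivity
    have hy : 0 < y := by positivity
    have hc : 0 ≤ θ ^ 2 * ((θ / 100) ^ (l + 1) * (θ / 100) ^ (k' + 1)) := by positivity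
    have hxy : 1 / (x ^ 2 * y ^ 2) ≤ 2 / (x + y) ^ 2 * (1 / x ^ 2 + 1 / y ^ 2) := by
      rw [div_add_div _ _ (by positivity) (by positivity), div_mul_div_comm,
        div_le_div_iff₀ (by positivity) (by positivity)]
      have : (x + y) ^ 2 ≤ 2 * (1 * y ^ 2 + x ^ 2 * 1) := by nlinarith [sq_nonneg (x - y)]
      have hp : 0 ≤ x ^ 2 * y ^ 2 := by positivity
      nlinarith [mul_le_mul_of_nonneg_right this hp]
    generalize (θ / 100) ^ (l + 1) = u at *
    generalize (θ / 100) ^ (k' + 1) = v at *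
    calc _ = θ ^ 2 * (u * v) * (1 / (x ^ 2 * y ^ 2)) := by
          field_simp
      _ ≤ θ ^ 2 * (u * v) * (2 / (x + y) ^ 2 * (1 / x ^ 2 + 1 / y ^ 2)) := mul_le_mul_of_nonneg_left hxy hc
      _ = _ := by field_simp
  refine (Finset.sum_le_sum term).trans ?_
  rw [← Finset.mul_sum, Finset.sum_add_distrib,
    Finset.sum_range_reflect (fun i => 1 / ((i : ℝ) + 1) ^ 2) k]
  have h2 := sum_inv_sq_le_two k
  have hn : 0 ≤ 2 * θ * runWeight θ (k + 1) :=
    mul_nonneg (by linarith) (runWeight_nonneg h0 _)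
  nlinarith

theorem runWeight_le_succ (h0 : 0 < θ) {n : ℕ} (hn : 1 ≤ n) :
    runWeight θ n ≤ 400 / θ * runWeight θ (n + 1) := by
  unfold runWeight
  have hn' : (1 : ℝ) ≤ n := by exact_mod_cast hn
  push_cast
  rw [pow_succ (θ / 100), show 400 / θ * (θ * ((θ / 100) ^ n * (θ / 100)) / ((n : ℝ) + 1) ^ 2)
    = θ * (θ / 100) ^ n * (4 / ((n : ℝ) + 1) ^ 2) by field_simp; ring]
  rw [div_eq_mul_one_div]
  refine mul_le_mul_of_nonneg_left ?_ (by positivity)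
  rw [div_le_div_iff₀ (by positivity) (by positivity)]
  nlinarith

end RunWeight

/-! ### The weight of all chains -/

section ChainWeight

variable {V : Type*} {N : Finset V} {H p₀ m f : ℕ}

/-- The requests that can occur in a chain covering the positions `0, …, k`. They start at the
position `k` at the latest, and without a mark they also end there at the latest. -/
def chainSupport (p₀ m : ℕ) (b : Bool) (k : ℕ) : Set (Request V) :=
  {c | Sum.elim (fun s => b = true ∧ ∃ κ ≤ k, s = p₀ + 1 + 2 * κ)
    (fun c => ∃ κ < m, c.2.1 = p₀ + 2 * κ ∧ 1 ≤ c.2.2 ∧ κ + 1 ≤ k + c.2.2 ∧ (b = false → κ ≤ k)) c}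

theorem inl_mem_chainSupport {s : ℕ} {b : Bool} {k : ℕ} :
    (Sum.inl s : Request V) ∈ chainSupport p₀ m b k ↔ b = true ∧ ∃ κ ≤ k, s = p₀ + 1 + 2 * κ :=
  Iff.rfl

theorem inr_mem_chainSupport {z : V} {κ l : ℕ} {b : Bool} {k : ℕ} :
    (Sum.inr (z, p₀ + 2 * κ, l) : Request V) ∈ chainSupport p₀ m b k ↔
      κ < m ∧ 1 ≤ l ∧ κ + 1 ≤ k + l ∧ (b = false → κ ≤ k) := by
  constructor
  · rintro ⟨κ', h1, h2, h3, h4, h5⟩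
    obtain rfl : κ = κ' := by simpa using h2
    exact ⟨h1, h3, h4, h5⟩
  · rintro ⟨h1, h3, h4, h5⟩
    exact ⟨κ, h1, rfl, h3, h4, h5⟩

theorem chainSupport_mono {b b' : Bool} {k k' : ℕ} (hb : b' = false → b = false) (hk : k ≤ k') :
    (chainSupport p₀ m b k : Set (Request V)) ⊆ chainSupport p₀ m b' k' := by
  rintro (s | ⟨z, e, l⟩)
  · rintro ⟨h, κ, h1, h2⟩
    refine ⟨?_, κ, by omega, h2⟩
    cases b'
    · simp [hb rfl] at h
    · rfl
  · rintro ⟨κ, h1, h2, h3, h4, h5⟩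
    exact ⟨κ, h1, h2, h3, by omega, fun h => (h5 (hb h)).trans hk⟩

/-- The requests that can be additional to a chain at a position `f` covered by the child `z`. They
are not runs of `z`, and do not occur in an unmarked chain that covers only positions before `f`. -/
def extraSupport (p₀ m f : ℕ) (z : V) : Set (Request V) :=
  {c | (∃ s, c = Sum.inl s ∧ s = p₀ + 1 + 2 * f) ∨ ∃ z' κ l, z' ≠ z ∧ f ≤ κ ∧
    κ + 1 ≤ f + l ∧ κ < m ∧ 1 ≤ l ∧ c = Sum.inr (z', p₀ + 2 * κ, l)}

theorem extraSupport_subset {z : V} {k : ℕ} (hf : f ≤ k) :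
    extraSupport p₀ m f z ⊆ chainSupport p₀ m true k := by
  rintro _ (⟨s, rfl, rfl⟩ | ⟨z', κ, l', -, h1, h2, h3, h4, rfl⟩)
  · exact ⟨rfl, f, hf, rfl⟩
  · rw [inr_mem_chainSupport]; simp; omega

theorem disjoint_extraSupport_chainSupport {z : V} {k : ℕ} (hf : k < f) :
    Disjoint (extraSupport p₀ m f z) (chainSupport p₀ m false k) := by
  rw [Set.disjoint_left]
  rintro _ (⟨s, rfl, rfl⟩ | ⟨z', κ, l', -, h1, h2, h3, h4, rfl⟩)
  · rintro ⟨h, -⟩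
    simp at h
  · rw [inr_mem_chainSupport]; simp; omega

theorem inr_notMem_extraSupport {z : V} {e l : ℕ} :
    (Sum.inr (z, e, l) : Request V) ∉ extraSupport p₀ m f z := by
  rintro (⟨s, h, -⟩ | ⟨z', κ, l', hne, -, -, -, -, h⟩)
  · simp at h
  · simp only [Sum.inr.injEq, Prod.mk.injEq] at h
    exact hne h.1.symm

/-- The assumptions on the weights of requests under which all chains together have a small
weight. Runs that start before the window, or at its start, have an extra factor `θ`. -/
structure IsChainWeight (N : Finset V) (p₀ : ℕ) (θ ε : ℝ) (w : Request V → ℝ) : Prop where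
  pos : 0 < θ
  card : 16 * (N.card : ℝ) * θ ≤ 1
  le_one : 16 * θ ≤ 1
  eps : 10000 * ε ≤ θ ^ 3
  nonneg : ∀ c, 0 ≤ w c
  inl : ∀ s, w (Sum.inl s) ≤ ε
  inr : ∀ z e l, w (Sum.inr (z, e, l)) ≤ runWeight θ l
  inr_start : ∀ z k i, w (Sum.inr (z, p₀ + 2 * k, k + 1 + i)) ≤ θ * runWeight θ (k + 1 + i)

variable {θ ε : ℝ} {w : Request V → ℝ}

/-- The bound on the total weight of the chains that cover `n` positions. -/
noncomputable def chainWeight (θ : ℝ) (b : Bool) (n : ℕ) : ℝ :=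
  (if b then θ else 1 / 4) * runWeight θ n

namespace IsChainWeight

variable (hw : IsChainWeight N p₀ θ ε w)
include hw

theorem chainWeight_nonneg (b : Bool) (n : ℕ) : 0 ≤ chainWeight θ b n := by
  have := hw.pos.le
  unfold chainWeight
  split_ifs <;> exact mul_nonneg (by positivity) (runWeight_nonneg this _)

theorem card_mul_le {x : ℝ} (hx : 0 ≤ x) : 16 * (N.card * (θ * x)) ≤ x := by
  have := mul_le_mul_of_nonneg_right hw.card hx
  linarith

theorem isCovered_step {b : Bool} {k : ℕ} (hk : k < m)
    (ih : ∀ k' < k, IsCovered w (chainSupport p₀ m b k')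
      {S | Chain N H p₀ m f S b k'} (chainWeight θ b (k' + 1))) :
    IsCovered w (chainSupport p₀ m b k)
      {S | ∃ z ∈ N, ∃ k' ∈ Finset.range k, Sum.inr (z, p₀ + 2 * k, k - k') ∈ S ∧
        Chain N H p₀ m f S b k'} (1 / 2 * chainWeight θ b (k + 1)) := by
  refine (IsCovered.biUnion hw.nonneg N fun z _ => IsCovered.biUnion (β := fun k' => runWeight θ (k - k') * chainWeight θ b (k' + 1)) hw.nonneg (Finset.range k)
    fun k' hk' => ?_).mono subset_rfl subset_rfl ?_
  · rw [Finset.mem_range] at hk'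
    refine (ih k' hk').inter_mem hw.nonneg (hw.chainWeight_nonneg _ _) ?_ ?_ ?_ (hw.inr _ _ _)
    · rw [inr_mem_chainSupport]; omega
    · rw [inr_mem_chainSupport]; omega
    · exact chainSupport_mono id hk'.le
  · rw [Finset.sum_const, nsmul_eq_mul]
    unfold chainWeight
    set κ : ℝ := if b then θ else 1 / 4
    have hκ : 0 ≤ κ := by
      have := hw.pos.le
      unfold κ; split_ifs <;> positivity
    have h1 : ∑ k' ∈ Finset.range k, runWeight θ (k - k') * (κ * runWeight θ (k' + 1))
        ≤ κ * (8 * θ * runWeight θ (k + 1)) := by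
      rw [Finset.sum_congr rfl fun k' _ => mul_left_comm (runWeight θ (k - k')) κ _,
        ← Finset.mul_sum]
      exact mul_le_mul_of_nonneg_left (sum_runWeight_mul_runWeight_le hw.pos.le k) hκ
    have h2 := mul_le_mul_of_nonneg_left h1 (Nat.cast_nonneg (α := ℝ) N.card)
    have h3 := hw.card_mul_le (mul_nonneg hκ (runWeight_nonneg hw.pos.le (k + 1)))
    linarith

theorem isCovered_last {k : ℕ} (hk : k < m) (b : Bool) :
    IsCovered w (chainSupport p₀ m b k)
      {S | ∃ z ∈ N, ∃ i ∈ Finset.range (H + 1), Sum.inr (z, p₀ + 2 * k, k + 1 + i) ∈ S}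
      (1 / 8 * runWeight θ (k + 1)) := by
  have hθ := hw.pos.le
  refine (IsCovered.biUnion hw.nonneg N fun z _ => IsCovered.biUnion (β := fun i => θ * runWeight θ (k + 1 + i)) hw.nonneg
    (Finset.range (H + 1)) fun i _ => ?_).mono subset_rfl subset_rfl ?_
  · refine IsCovered.mem ?_ (hw.inr_start _ _ _)
    rw [inr_mem_chainSupport]; omega
  · rw [Finset.sum_const, nsmul_eq_mul, ← Finset.mul_sum]
    have h1 := sum_runWeight_add_le hθ (by linarith [hw.le_one]) (n := k + 1) (by omega) H
    have h2 := mul_le_mul_of_nonneg_left (mul_le_mul_of_nonneg_left h1 hθ)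
      (Nat.cast_nonneg (α := ℝ) N.card)
    have h3 := hw.card_mul_le (runWeight_nonneg hθ (k + 1))
    linarith

theorem isCovered_unmarked {k : ℕ} (hk : k < m) :
    IsCovered w (chainSupport p₀ m false k) {S | Chain N H p₀ m f S false k}
      (chainWeight θ false (k + 1)) := by
  induction k using Nat.strong_induction_on with
  | _ k ih =>
  refine ((hw.isCovered_step hk fun k' hk' => ih k' hk' (by omega)).union hw.nonneg
    (hw.isCovered_last (H := H) hk false)).mono subset_rfl ?_ ?_
  · intro S hS
    cases hS with
    | step hz hk' _ h hc => exact Or.inl ⟨_, hz, _, Finset.mem_range.2 hk', h, hc⟩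
    | last hz hi _ h => exact Or.inr ⟨_, hz, _, Finset.mem_range.2 (by omega), h⟩
  · simp only [chainWeight, Bool.false_eq_true, if_false]
    linarith

theorem isCovered_chain_of_marked {k : ℕ} (hk : k < m)
    (h : IsCovered w (chainSupport p₀ m true k) {S | Chain N H p₀ m f S true k}
      (chainWeight θ true (k + 1))) :
    IsCovered w (chainSupport p₀ m true k) {S | ∃ b, Chain N H p₀ m f S b k}
      (1 / 2 * runWeight θ (k + 1)) := by
  refine (((hw.isCovered_unmarked (H := H) (f := f) hk).mono (chainSupport_mono (by simp) le_rfl) subset_rfl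
    le_rfl).union hw.nonneg h).mono subset_rfl ?_ ?_
  · rintro S ⟨b, hb⟩
    cases b
    exacts [Or.inl hb, Or.inr hb]
  · simp only [chainWeight, Bool.false_eq_true, if_false, if_true]
    have h1 := mul_le_mul_of_nonneg_right hw.le_one (runWeight_nonneg hw.pos.le (k + 1))
    linarith [runWeight_nonneg hw.pos.le (k + 1)]

theorem isCovered_defect {k : ℕ}
    (h : IsCovered w (chainSupport p₀ m true k) {S | ∃ b, Chain N H p₀ m f S b k}
      (1 / 2 * runWeight θ (k + 1))) :
    IsCovered w (chainSupport p₀ m true (k + 1))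
      {S | Sum.inl (p₀ + 1 + 2 * (k + 1)) ∈ S ∧ ∃ b, Chain N H p₀ m f S b k}
      (θ / 50 * (θ * runWeight θ (k + 2))) := by
  have hr := runWeight_nonneg hw.pos.le
  refine (h.inter_mem hw.nonneg (by linarith [hr (k + 1)]) ?_ ?_ (chainSupport_mono id (by omega))
    (hw.inl _)).mono subset_rfl subset_rfl ?_
  · rw [inl_mem_chainSupport]; omega
  · exact ⟨rfl, k + 1, le_rfl, rfl⟩
  · have h1 := runWeight_le_succ hw.pos (n := k + 1) (by omega)
    have hε : ε ≤ θ ^ 3 / 10000 := by linarith [hw.eps]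
    calc ε * (1 / 2 * runWeight θ (k + 1))
        ≤ θ ^ 3 / 10000 * (1 / 2 * (400 / θ * runWeight θ (k + 2))) := by
          refine mul_le_mul hε (by linarith) (by linarith [hr (k + 1)]) ?_
          have := hw.pos
          positivity
      _ = θ / 50 * (θ * runWeight θ (k + 2)) := by
          have := hw.pos.ne'
          field_simp
          ring

theorem isCovered_defect_last :
    IsCovered w (chainSupport p₀ m true 0) {S | Sum.inl (p₀ + 1) ∈ S}
      (1 / 100 * (θ * runWeight θ 1)) := by
  refine IsCovered.mem ⟨rfl, 0, le_rfl, by omega⟩ ((hw.inl _).trans ?_)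
  have h : runWeight θ 1 = θ ^ 2 / 100 := by
    unfold runWeight
    norm_num
    ring
  rw [h]
  linarith [hw.eps]

theorem isCovered_overlap {k : ℕ}
    (ih : ∀ k' < k, IsCovered w (chainSupport p₀ m true k')
      {S | ∃ b, Chain N H p₀ m f S b k'} (1 / 2 * runWeight θ (k' + 1))) :
    IsCovered w (chainSupport p₀ m true k)
      {S | ∃ z ∈ N, ∃ j ∈ Finset.range (H + 1), ∃ k' ∈ Finset.range k, k + (j + 1) < m ∧
        Sum.inr (z, p₀ + 2 * (k + (j + 1)), k - k' + (j + 1)) ∈ S ∧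
        ∃ b, Chain N H p₀ m f S b k'} (1 / 100 * (θ * runWeight θ (k + 1))) := by
  have hθ := hw.pos.le
  refine (IsCovered.biUnion hw.nonneg N fun z _ => IsCovered.biUnion hw.nonneg
    (Finset.range (H + 1)) fun j _ => IsCovered.biUnion (β := fun k' => runWeight θ (k - k' + (j + 1)) * (1 / 2 * runWeight θ (k' + 1))) hw.nonneg (Finset.range k)
    fun k' hk' => ?_).mono subset_rfl subset_rfl ?_
  · rw [Finset.mem_range] at hk'
    have h0 : 0 ≤ 1 / 2 * runWeight θ (k' + 1) := by linarith [runWeight_nonneg hθ (k' + 1)]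
    by_cases hj : k + (j + 1) < m
    · refine ((ih k' hk').inter_mem
        (c := Sum.inr (z, p₀ + 2 * (k + (j + 1)), k - k' + (j + 1))) hw.nonneg h0 ?_ ?_ ?_
        (hw.inr _ _ _)).mono subset_rfl ?_ le_rfl
      · rw [inr_mem_chainSupport]; omega
      · rw [inr_mem_chainSupport]; simp; omega
      · exact chainSupport_mono id hk'.le
      · exact fun S hS => hS.2
    · exact IsCovered.of_isEmpty (fun S hS => hj hS.1) (mul_nonneg (runWeight_nonneg hθ _) h0)
  · rw [Finset.sum_const, nsmul_eq_mul, Finset.sum_comm]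
    have h1 : ∑ k' ∈ Finset.range k, ∑ j ∈ Finset.range (H + 1),
        runWeight θ (k - k' + (j + 1)) * (1 / 2 * runWeight θ (k' + 1))
        ≤ θ / 100 * (8 * θ * runWeight θ (k + 1)) := by
      refine le_trans ?_ (mul_le_mul_of_nonneg_left (sum_runWeight_mul_runWeight_le hθ k)
        (by positivity))
      rw [Finset.mul_sum]
      refine Finset.sum_le_sum fun k' hk' => ?_
      rw [Finset.mem_range] at hk'
      rw [← Finset.sum_mul]
      have := mul_le_mul_of_nonneg_right (sum_runWeight_add_succ_le hθ (by linarith [hw.le_one])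
        (n := k - k') (by omega) H) (runWeight_nonneg hθ (k' + 1))
      linarith
    have h2 := mul_le_mul_of_nonneg_left h1 (Nat.cast_nonneg (α := ℝ) N.card)
    have h3 := hw.card_mul_le (mul_nonneg hθ (runWeight_nonneg hθ (k + 1)))
    linarith [mul_nonneg hθ (runWeight_nonneg hθ (k + 1))]

theorem isCovered_overlap_last {k : ℕ} :
    IsCovered w (chainSupport p₀ m true k)
      {S | ∃ z ∈ N, ∃ i ∈ Finset.range (H + 1), ∃ j ∈ Finset.range (H + 1), k + (j + 1) < m ∧
        Sum.inr (z, p₀ + 2 * (k + (j + 1)), k + 1 + i + (j + 1)) ∈ S}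
      (1 / 100 * (θ * runWeight θ (k + 1))) := by
  have hθ := hw.pos.le
  have hθ1 : θ ≤ 1 := by linarith [hw.le_one]
  have hr := runWeight_nonneg hθ
  refine (IsCovered.biUnion hw.nonneg N fun z _ => IsCovered.biUnion hw.nonneg
    (Finset.range (H + 1)) fun i _ => IsCovered.biUnion (β := fun j => θ * runWeight θ (k + 1 + i + (j + 1))) hw.nonneg (Finset.range (H + 1))
    fun j _ => ?_).mono subset_rfl subset_rfl ?_
  · by_cases hj : k + (j + 1) < m
    · refine (IsCovered.mem (w := w) (c := Sum.inr (z, p₀ + 2 * (k + (j + 1)), k + 1 + i + (j + 1)))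
        ?_ ?_).mono subset_rfl (fun S hS => hS.2) le_rfl
      · rw [inr_mem_chainSupport]; simp; omega
      · have := hw.inr_start z (k + (j + 1)) i
        rwa [show k + (j + 1) + 1 + i = k + 1 + i + (j + 1) by omega] at this
    · exact IsCovered.of_isEmpty (fun S hS => hj hS.1) (mul_nonneg hθ (hr _))
  · rw [Finset.sum_const, nsmul_eq_mul]
    have h1 : ∑ i ∈ Finset.range (H + 1), ∑ j ∈ Finset.range (H + 1),
        θ * runWeight θ (k + 1 + i + (j + 1)) ≤ θ * (θ / 50 * (2 * runWeight θ (k + 1))) := by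
      refine le_trans ?_ (mul_le_mul_of_nonneg_left (mul_le_mul_of_nonneg_left
        (sum_runWeight_add_le hθ hθ1 (n := k + 1) (by omega) H) (by positivity)) hθ)
      rw [Finset.mul_sum, Finset.mul_sum]
      refine Finset.sum_le_sum fun i _ => ?_
      rw [← Finset.mul_sum]
      exact mul_le_mul_of_nonneg_left (sum_runWeight_add_succ_le hθ hθ1 (by omega) H) hθ
    have h2 := mul_le_mul_of_nonneg_left h1 (Nat.cast_nonneg (α := ℝ) N.card)
    have h3 := hw.card_mul_le (mul_nonneg hθ (hr (k + 1)))
    linarith [mul_nonneg hθ (hr (k + 1))]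

theorem isCovered_extra (z : V) :
    IsCovered w (extraSupport p₀ m f z)
      {S | ExtraRequest N H p₀ m S f z} (θ / 100) := by
  have hθ := hw.pos.le
  have hθ1 : θ ≤ 1 := by linarith [hw.le_one]
  have hr := runWeight_nonneg hθ
  have h2 : IsCovered w (extraSupport p₀ m f z)
      {S | ∃ z' ∈ N, ∃ i ∈ Finset.range (H + 1), ∃ j ∈ Finset.range (H + 1), (z' ≠ z ∧ f + j < m) ∧
        Sum.inr (z', p₀ + 2 * (f + j), 1 + i + j) ∈ S} (θ / 200) := by
    refine (IsCovered.biUnion hw.nonneg N fun z' _ => IsCovered.biUnion hw.nonneg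
      (Finset.range (H + 1)) fun i _ => IsCovered.biUnion (β := fun j => runWeight θ (1 + i + j)) hw.nonneg (Finset.range (H + 1))
      fun j _ => ?_).mono subset_rfl subset_rfl ?_
    · by_cases hj : z' ≠ z ∧ f + j < m
      · refine (IsCovered.mem (w := w) (c := Sum.inr (z', p₀ + 2 * (f + j), 1 + i + j))
          ?_ (hw.inr _ _ _)).mono subset_rfl (fun S hS => hS.2) le_rfl
        exact Or.inr ⟨z', f + j, 1 + i + j, hj.1, by omega, by omega, hj.2, by omega, rfl⟩
      · exact IsCovered.of_isEmpty (fun S hS => hj hS.1) (hr _)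
    · rw [Finset.sum_const, nsmul_eq_mul]
      have h1 : ∑ i ∈ Finset.range (H + 1), ∑ j ∈ Finset.range (H + 1),
          runWeight θ (1 + i + j) ≤ 2 * (2 * runWeight θ 1) := by
        refine le_trans ?_ (mul_le_mul_of_nonneg_left
          (sum_runWeight_add_le hθ hθ1 (n := 1) le_rfl H) (by norm_num))
        rw [Finset.mul_sum]
        exact Finset.sum_le_sum fun i _ => sum_runWeight_add_le hθ hθ1 (by omega) H
      have h : runWeight θ 1 = θ * (θ / 100) := by
        unfold runWeight
        norm_num
      rw [h] at h1
      have h2 := mul_le_mul_of_nonneg_left h1 (Nat.cast_nonneg (α := ℝ) N.card)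
      have h3 := hw.card_mul_le hθ
      linarith
  refine ((IsCovered.mem (w := w) (c := Sum.inl (p₀ + 1 + 2 * f)) (Or.inl ⟨_, rfl, rfl⟩)
    (hw.inl _)).union hw.nonneg h2).mono subset_rfl ?_ ?_
  · rintro S (h | ⟨z', hz', hne, i, hi, j, hj, hm, h⟩)
    · exact Or.inl h
    · exact Or.inr ⟨z', hz', i, Finset.mem_range.2 (by omega), j, Finset.mem_range.2 (by omega),
        ⟨hne, hm⟩, h⟩
  · have : θ ^ 3 ≤ θ := by
      have := pow_le_one₀ (n := 2) hθ hθ1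
      nlinarith
    linarith [hw.eps]

theorem isCovered_extra_step {k : ℕ} (hfk : f ≤ k) (hk : k < m) :
    IsCovered w (chainSupport p₀ m true k)
      {S | ∃ z ∈ N, ∃ k' ∈ Finset.range k, k' < f ∧ Sum.inr (z, p₀ + 2 * k, k - k') ∈ S ∧
        ExtraRequest N H p₀ m S f z ∧ Chain N H p₀ m f S false k'}
      (1 / 100 * (θ * runWeight θ (k + 1))) := by
  have hθ := hw.pos.le
  have hr := runWeight_nonneg hθ
  refine (IsCovered.biUnion hw.nonneg N fun z _ => IsCovered.biUnion
    (β := fun k' => runWeight θ (k - k') * (θ / 100 * chainWeight θ false (k' + 1))) hw.nonneg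
    (Finset.range k) fun k' hk' => ?_).mono subset_rfl subset_rfl ?_
  · rw [Finset.mem_range] at hk'
    have h0 : 0 ≤ θ / 100 * chainWeight θ false (k' + 1) :=
      mul_nonneg (by positivity) (hw.chainWeight_nonneg _ _)
    by_cases hk'f : k' < f
    · have hrest := hw.isCovered_unmarked (N := N) (H := H) (f := f) (hk'.trans hk)
      refine (((hw.isCovered_extra z).inter hw.nonneg hrest
        (disjoint_extraSupport_chainSupport hk'f)).inter_mem
        (c := Sum.inr (z, p₀ + 2 * k, k - k')) hw.nonneg h0 ?_ ?_ ?_ (hw.inr _ _ _)).mono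
        subset_rfl (fun S hS => hS.2) le_rfl
      · rw [Set.mem_union, not_or, inr_mem_chainSupport]
        exact ⟨inr_notMem_extraSupport, by omega⟩
      · rw [inr_mem_chainSupport]; omega
      · exact Set.union_subset (extraSupport_subset hfk) (chainSupport_mono (by simp) hk'.le)
    · exact IsCovered.of_isEmpty (fun S hS => hk'f hS.1) (mul_nonneg (hr _) h0)
  · rw [Finset.sum_const, nsmul_eq_mul]
    have h1 : ∑ k' ∈ Finset.range k,
        runWeight θ (k - k') * (θ / 100 * chainWeight θ false (k' + 1))
        ≤ θ / 400 * (8 * θ * runWeight θ (k + 1)) := by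
      refine le_trans ?_ (mul_le_mul_of_nonneg_left (sum_runWeight_mul_runWeight_le hθ k)
        (by positivity))
      rw [Finset.mul_sum]
      refine Finset.sum_le_sum fun k' _ => le_of_eq ?_
      simp only [chainWeight, Bool.false_eq_true, if_false]
      ring
    have h2 := mul_le_mul_of_nonneg_left h1 (Nat.cast_nonneg (α := ℝ) N.card)
    have h3 := hw.card_mul_le (mul_nonneg hθ (hr (k + 1)))
    linarith [mul_nonneg hθ (hr (k + 1))]

theorem isCovered_extra_last {k : ℕ} (hfk : f ≤ k) (hk : k < m) :
    IsCovered w (chainSupport p₀ m true k)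
      {S | ∃ z ∈ N, ∃ i ∈ Finset.range (H + 1), Sum.inr (z, p₀ + 2 * k, k + 1 + i) ∈ S ∧
        ExtraRequest N H p₀ m S f z} (1 / 100 * (θ * runWeight θ (k + 1))) := by
  have hθ := hw.pos.le
  have hθ1 : θ ≤ 1 := by linarith [hw.le_one]
  have hr := runWeight_nonneg hθ
  refine (IsCovered.biUnion hw.nonneg N fun z _ => IsCovered.biUnion
    (β := fun i => θ * runWeight θ (k + 1 + i) * (θ / 100)) hw.nonneg
    (Finset.range (H + 1)) fun i _ => ?_).mono subset_rfl subset_rfl ?_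
  · refine (hw.isCovered_extra z).inter_mem hw.nonneg (by positivity)
      inr_notMem_extraSupport ?_ (extraSupport_subset hfk) (hw.inr_start _ _ _)
    rw [inr_mem_chainSupport]; omega
  · rw [Finset.sum_const, nsmul_eq_mul, ← Finset.sum_mul, ← Finset.mul_sum]
    have h1 := sum_runWeight_add_le hθ hθ1 (n := k + 1) (by omega) H
    have h2 := mul_le_mul_of_nonneg_left (mul_le_mul_of_nonneg_right
      (mul_le_mul_of_nonneg_left h1 hθ) (by positivity : 0 ≤ θ / 100))
      (Nat.cast_nonneg (α := ℝ) N.card)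
    have h3 := hw.card_mul_le (mul_nonneg hθ (hr (k + 1)))
    linarith [mul_nonneg hθ (hr (k + 1))]

theorem isCovered_marked {k : ℕ} (hk : k < m) :
    IsCovered w (chainSupport p₀ m true k) {S | Chain N H p₀ m f S true k}
      (chainWeight θ true (k + 1)) := by
  induction k using Nat.strong_induction_on with
  | _ k ih =>
  have hθ := hw.pos.le
  have hr := mul_nonneg hθ (runWeight_nonneg hθ (k + 1))
  have hany (k' : ℕ) (hk' : k' < k) := hw.isCovered_chain_of_marked (by omega) (ih k' hk' (by omega))
  have hdefect : IsCovered w (chainSupport p₀ m true k)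
      {S | (∃ k', k = k' + 1 ∧ Sum.inl (p₀ + 1 + 2 * k) ∈ S ∧ ∃ b, Chain N H p₀ m f S b k') ∨
        k = 0 ∧ Sum.inl (p₀ + 1) ∈ S} (1 / 50 * (θ * runWeight θ (k + 1))) := by
    rcases k with - | k
    · exact hw.isCovered_defect_last.mono subset_rfl (by intro S; simp) (by linarith)
    · refine (hw.isCovered_defect (hany k (by omega))).mono subset_rfl ?_ ?_
      · rintro S (⟨k', hk', h⟩ | ⟨h, -⟩)
        · obtain rfl : k = k' := by omega
          exact h
        · omega
      · exact mul_le_mul_of_nonneg_right (by linarith [hw.le_one]) hr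
  have hextra : IsCovered w (chainSupport p₀ m true k)
      {S | f ≤ k ∧ ((∃ z ∈ N, ∃ k' ∈ Finset.range k, k' < f ∧ Sum.inr (z, p₀ + 2 * k, k - k') ∈ S ∧
        ExtraRequest N H p₀ m S f z ∧ Chain N H p₀ m f S false k') ∨
        ∃ z ∈ N, ∃ i ∈ Finset.range (H + 1), Sum.inr (z, p₀ + 2 * k, k + 1 + i) ∈ S ∧
        ExtraRequest N H p₀ m S f z)} (1 / 50 * (θ * runWeight θ (k + 1))) := by
    by_cases hfk : f ≤ k
    · exact ((hw.isCovered_extra_step hfk hk).union hw.nonneg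
        (hw.isCovered_extra_last hfk hk)).mono subset_rfl (fun S hS => hS.2) (by linarith)
    · exact IsCovered.of_isEmpty (fun S hS => hfk hS.1) (by linarith)
  refine ((hw.isCovered_step hk fun k' hk' => ih k' hk' (by omega)).union hw.nonneg
    (hdefect.union hw.nonneg (hextra.union hw.nonneg
    ((hw.isCovered_overlap (H := H) hany).union hw.nonneg
      (hw.isCovered_overlap_last (H := H) (m := m)))))).mono
    subset_rfl ?_ ?_
  · intro S hS
    cases hS with
    | step hz hk' _ h hc => exact Or.inl ⟨_, hz, _, Finset.mem_range.2 hk', h, hc⟩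
    | defect _ h hc => exact Or.inr (Or.inl (Or.inl ⟨_, rfl, h, _, hc⟩))
    | defect_last _ h => exact Or.inr (Or.inl (Or.inr ⟨rfl, h⟩))
    | extra hz hk' hf _ h he hc =>
      exact Or.inr (Or.inr (Or.inl ⟨hf, Or.inl
        ⟨_, hz, _, Finset.mem_range.2 (by omega), hk', h, he, hc⟩⟩))
    | extra_last hz hi hf _ h he =>
      exact Or.inr (Or.inr (Or.inl ⟨hf, Or.inr ⟨_, hz, _, Finset.mem_range.2 (by omega), h, he⟩⟩))
    | overlap hz hk' hj hm h hc =>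
      exact Or.inr (Or.inr (Or.inr (Or.inl ⟨_, hz, _, Finset.mem_range.2 (by omega), _,
        Finset.mem_range.2 hk', hm, h, _, hc⟩)))
    | overlap_last hz hi hj hm h =>
      exact Or.inr (Or.inr (Or.inr (Or.inr ⟨_, hz, _, Finset.mem_range.2 (by omega), _,
        Finset.mem_range.2 (by omega), hm, h⟩)))
  · simp only [chainWeight, if_true]
    linarith

end IsChainWeight
end ChainWeight

/-! ### The process with a forced vertex -/

section Forced

variable {V : Type*}

/-- The set of vertices with spin `-1` at a given time, when `Δ` is the set of pairs (time, vertex)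
with a noise update to `-1`, noise updates to `1` are replaced by minus bias updates, and the vertex
`x` has spin `-1` exactly at the times in `R`. All other vertices start from `1`. -/
def minusSet (G : SimpleGraph V) (Δ : Set (ℕ × V)) (x : V) (R : Set ℕ) : ℕ → Set V
  | 0 => {u | u = x ∧ 0 ∈ R}
  | s + 1 => {u | (u = x ∧ s + 1 ∈ R) ∨ u ≠ x ∧ ((s + 1, u) ∈ Δ ∨
      ∃ y₁ y₂, y₁ ≠ y₂ ∧ G.Adj u y₁ ∧ G.Adj u y₂ ∧ y₁ ∈ minusSet G Δ x R s ∧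
        y₂ ∈ minusSet G Δ x R s)}

/-- The times at which `y` has spin `-1` if `x` has spin `-1` at the times in `R`. -/
def minusTimes (G : SimpleGraph V) (Δ : Set (ℕ × V)) (x : V) (R : Set ℕ) (y : V) : Set ℕ :=
  {s | y ∈ minusSet G Δ x R s}

/-- The component of `y` after removal of the edge between `x` and `y`. -/
def side (G : SimpleGraph V) (x y : V) : Set V := {u | (G.deleteEdges {s(x, y)}).Reachable y u}

variable {G : SimpleGraph V} {Δ : Set (ℕ × V)} {x y z u v : V} {R : Set ℕ}

theorem mem_minusSet_self {s : ℕ} : x ∈ minusSet G Δ x R s ↔ s ∈ R := by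
  cases s <;> simp [minusSet]

theorem notMem_minusSet_zero (h : u ≠ x) : u ∉ minusSet G Δ x R 0 := by
  simp [minusSet, h]

theorem zero_notMem_minusTimes (h : y ≠ x) : 0 ∉ minusTimes G Δ x R y :=
  notMem_minusSet_zero (G := G) (Δ := Δ) (R := R) h

theorem mem_minusSet_succ {s : ℕ} (h : u ≠ x) : u ∈ minusSet G Δ x R (s + 1) ↔ (s + 1, u) ∈ Δ ∨
    ∃ y₁ y₂, y₁ ≠ y₂ ∧ G.Adj u y₁ ∧ G.Adj u y₂ ∧ y₁ ∈ minusSet G Δ x R s ∧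
      y₂ ∈ minusSet G Δ x R s := by
  simp [minusSet, h]

theorem mem_side_self : y ∈ side G x y := SimpleGraph.Reachable.refl _

theorem notMem_side (hG : G.IsAcyclic) (h : G.Adj x y) : x ∉ side G x y := by
  have hb := SimpleGraph.isAcyclic_iff_forall_adj_isBridge.1 hG h
  rw [SimpleGraph.isBridge_iff] at hb
  exact fun hx => hb (SimpleGraph.Reachable.symm hx)

theorem mem_side_of_ne (hu : u ∈ side G x y) (huv : G.Adj u v) (hne : s(u, v) ≠ s(x, y)) :
    v ∈ side G x y := by
  refine SimpleGraph.Reachable.trans hu (SimpleGraph.Adj.reachable ?_)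
  rw [SimpleGraph.deleteEdges_adj]
  exact ⟨huv, hne⟩

theorem mem_side_of_adj (hG : G.IsAcyclic) (h : G.Adj x y) (hu : u ∈ side G x y)
    (huv : G.Adj u v) (hv : v ≠ x) : v ∈ side G x y := by
  refine mem_side_of_ne hu huv fun he => ?_
  rw [Sym2.eq_iff] at he
  rcases he with ⟨rfl, -⟩ | ⟨-, rfl⟩
  · exact notMem_side hG h hu
  · exact hv rfl

theorem side_induction {P : V → Prop} (h0 : P y)
    (hstep : ∀ u v, u ∈ side G x y → P u → G.Adj u v → v ∈ side G x y → P v) :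
    ∀ u ∈ side G x y, P u := by
  intro u hu
  have hu' := hu
  change (G.deleteEdges {s(x, y)}).Reachable y u at hu'
  rw [SimpleGraph.reachable_iff_reflTransGen] at hu'
  induction hu' with
  | refl => exact h0
  | tail hab hbc ih =>
    have hb := (SimpleGraph.reachable_iff_reflTransGen _ _).2 hab
    exact hstep _ _ hb (ih hb) (SimpleGraph.deleteEdges_le _ hbc) hu

theorem side_subset_side (hG : G.IsAcyclic) (hxy : G.Adj x y) (hyz : G.Adj y z) (hzx : z ≠ x) :
    side G y z ⊆ side G x y := by
  refine side_induction (mem_side_of_adj hG hxy mem_side_self hyz hzx) fun u v hu ih huv hv => ?_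
  refine mem_side_of_adj hG hxy ih huv ?_
  rintro rfl
  refine notMem_side hG hyz (mem_side_of_ne hv hxy ?_)
  rw [Ne, Sym2.eq_iff]
  rintro (⟨rfl, -⟩ | ⟨rfl, -⟩)
  · exact hxy.ne rfl
  · exact hzx rfl

theorem disjoint_side (hG : G.IsAcyclic) {z' : V} (hz : G.Adj y z) (hz' : G.Adj y z')
    (hne : z ≠ z') : Disjoint (side G y z) (side G y z') := by
  rw [Set.disjoint_right]
  have hy : ∀ u ∈ side G y z', u ≠ y := by
    rintro u hu rfl
    exact notMem_side hG hz' hu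
  refine side_induction (fun h => ?_) fun u v hu ih huv hv hv' => ?_
  · refine notMem_side hG hz (mem_side_of_ne h hz'.symm ?_)
    rw [Ne, Sym2.eq_iff]
    rintro (⟨rfl, -⟩ | ⟨rfl, -⟩)
    · exact hz'.ne rfl
    · exact hne rfl
  · exact ih (mem_side_of_adj hG hz hv' huv.symm (hy u hu))

/-- The vertices behind `z`, seen from `y`, depend on the rest of the tree only through `y`. -/
theorem mem_minusSet_iff_of_mem_side (hG : G.IsAcyclic) (hxy : G.Adj x y) (hyz : G.Adj y z)
    (hzx : z ≠ x) {s : ℕ} (hu : u ∈ side G y z) :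
    u ∈ minusSet G Δ x R s ↔ u ∈ minusSet G Δ y (minusTimes G Δ x R y) s := by
  have hne : ∀ u ∈ side G y z, u ≠ x ∧ u ≠ y := fun u hu =>
    ⟨fun h => notMem_side hG hxy (h ▸ side_subset_side hG hxy hyz hzx hu),
      fun h => notMem_side hG hyz (h ▸ hu)⟩
  induction s generalizing u with
  | zero =>
    exact iff_of_false (notMem_minusSet_zero (hne u hu).1) (notMem_minusSet_zero (hne u hu).2)
  | succ s ih =>
    have key : ∀ w, G.Adj u w →
        (w ∈ minusSet G Δ x R s ↔ w ∈ minusSet G Δ y (minusTimes G Δ x R y) s) := by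
      intro w hw
      by_cases hwy : w = y
      · subst hwy
        rw [mem_minusSet_self]
        rfl
      · exact ih (mem_side_of_adj hG hyz hu hw hwy)
    rw [mem_minusSet_succ (hne u hu).1, mem_minusSet_succ (hne u hu).2]
    refine or_congr Iff.rfl (exists_congr fun y₁ => exists_congr fun y₂ => ?_)
    constructor
    · rintro ⟨h, h₁, h₂, h₃, h₄⟩
      exact ⟨h, h₁, h₂, (key _ h₁).1 h₃, (key _ h₂).1 h₄⟩
    · rintro ⟨h, h₁, h₂, h₃, h₄⟩
      exact ⟨h, h₁, h₂, (key _ h₁).2 h₃, (key _ h₂).2 h₄⟩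

theorem minusTimes_child (hG : G.IsAcyclic) (hxy : G.Adj x y) (hyz : G.Adj y z) (hzx : z ≠ x) :
    minusTimes G Δ y (minusTimes G Δ x R y) z = minusTimes G Δ x R z := by
  ext s
  exact (mem_minusSet_iff_of_mem_side hG hxy hyz hzx mem_side_self).symm

/-- `IsRun M R B H (q, m)`: the times `q, q - 2, …, q - 2 * (m - 1)` form a run of the set `M` of
times at which a vertex has spin `-1`, where `R` is the corresponding set for its parent. The run is
maximal, except that it may be cut at the horizon `H`; if it ends before the horizon, then the
parent has spin `-1` just after it. At the times in `B` that belong to the run, the parent did not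
have spin `-1` just before. -/
structure IsRun (M R B : Set ℕ) (H : ℕ) (ρ : ℕ × ℕ) : Prop where
  one_le : 1 ≤ ρ.2
  le : ρ.1 ≤ H
  mem : ∀ i < ρ.2, 2 * i ≤ ρ.1 ∧ ρ.1 - 2 * i ∈ M
  start : 2 * ρ.2 ≤ ρ.1 → ρ.1 - 2 * ρ.2 ∉ M
  ending : ρ.1 = H ∨ ρ.1 + 2 ∉ M ∧ ρ.1 + 1 ∈ R
  flag : ∀ f ∈ B, (∃ i < ρ.2, f + 2 * i = ρ.1) → ∀ r, r + 1 = f → r ∉ R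

/-- The time just before the start of a run, at which its position `0` is explained. -/
def runStart (ρ : ℕ × ℕ) : ℕ := ρ.1 + 1 - 2 * ρ.2

namespace IsRun

variable {M B B' : Set ℕ} {H : ℕ} {ρ ρ' : ℕ × ℕ}

theorem two_mul_le (h : IsRun M R B H ρ) (h0 : 0 ∉ M) : 2 * ρ.2 ≤ ρ.1 + 1 := by
  have h1 := h.one_le
  obtain ⟨h2, h3⟩ := h.mem (ρ.2 - 1) (by omega)
  by_contra hlt
  rw [show ρ.1 - 2 * (ρ.2 - 1) = 0 by omega] at h3
  exact h0 h3

/-- Different runs have no time in common. -/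
theorem eq_of_common_time (h : IsRun M R B H ρ) (h' : IsRun M R B H ρ') {i i' : ℕ} (hi : i < ρ.2)
    (hi' : i' < ρ'.2) (heq : ρ.1 - 2 * i = ρ'.1 - 2 * i') : ρ = ρ' := by
  obtain ⟨q, m⟩ := ρ
  obtain ⟨q', m'⟩ := ρ'
  have hb := (h.mem i hi).1
  have hb' := (h'.mem i' hi').1
  have hstart : ∀ {M R B : Set ℕ} {q m m'}, IsRun M R B H (q, m) → IsRun M R B H (q, m') →
      ¬ m < m' := fun h h' hlt => h.start (h'.mem _ hlt).1 (h'.mem _ hlt).2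
  have hlt : ∀ {M R B : Set ℕ} {q m q' m' i i'}, IsRun M R B H (q, m) → IsRun M R B H (q', m') →
      i < m → i' < m' → 2 * i ≤ q → 2 * i' ≤ q' → q - 2 * i = q' - 2 * i' → ¬ q < q' := by
    intro M R B q m q' m' i i' h h' hi hi' hb hb' heq hlt
    rcases h.ending with hs | hs
    · have := h'.le
      simp only at hs this
      omega
    · have := (h'.mem ((q' - q) / 2 - 1) (by simp only; omega)).2
      simp only at this hs
      rw [show q' - 2 * ((q' - q) / 2 - 1) = q + 2 by omega] at this
      exact hs.1 this
  have h1 := hlt h h' hi hi' hb hb' heq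
  have h2 := hlt h' h hi' hi hb' hb heq.symm
  obtain rfl : q = q' := by omega
  have h3 := hstart h h'
  have h4 := hstart h' h
  obtain rfl : m = m' := by omega
  rfl

theorem disjoint_chainSupport {W : Type*} (h : IsRun M R B H ρ) (h' : IsRun M R B H ρ')
    (h0 : 0 ∉ M) (hne : ρ ≠ ρ') :
    Disjoint (chainSupport (runStart ρ) ρ.2 true (ρ.2 - 1) : Set (Request W))
      (chainSupport (runStart ρ') ρ'.2 true (ρ'.2 - 1)) := by
  have h1 := h.one_le
  have h1' := h'.one_le
  have h2 := h.two_mul_le h0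
  have h2' := h'.two_mul_le h0
  rw [Set.disjoint_left]
  unfold runStart
  rintro (s | ⟨z, e, l⟩)
  · rintro ⟨-, κ, hκ, hs⟩ ⟨-, κ', hκ', hs'⟩
    exact hne (h.eq_of_common_time h' (i := ρ.2 - 1 - κ) (i' := ρ'.2 - 1 - κ') (by omega)
      (by omega) (by omega))
  · rintro ⟨κ, hκ, hs, -⟩ ⟨κ', hκ', hs', -⟩
    simp only at hs hs'
    exact hne (h.eq_of_common_time h' (i := ρ.2 - 1 - κ) (i' := ρ'.2 - 1 - κ') (by omega)
      (by omega) (by omega))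

end IsRun

/-- The requests that hold at `y` and its children, the neighbours other than `x`, if `y` has spin
`-1` at the times in `M`. -/
def satisfied (G : SimpleGraph V) (x y : V) (B : Set ℕ) (H : ℕ) (Δ : Set (ℕ × V)) (M : Set ℕ) :
    Set (Request V) :=
  {c | Sum.elim (fun s => (s, y) ∈ Δ)
    (fun c => (G.Adj y c.1 ∧ c.1 ≠ x) ∧ IsRun (minusTimes G Δ y M c.1) M B H c.2) c}

section Step

variable {B B' : Set ℕ} {H : ℕ} {ρ : ℕ × ℕ} {N : Finset V}

theorem exists_child_of_mem (hG : G.IsAcyclic) (hxy : G.Adj x y)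
    (hN : ∀ z, z ∈ N ↔ G.Adj y z ∧ z ≠ x) {s : ℕ} (hs : s + 1 ∈ minusTimes G Δ x R y) :
    (s + 1, y) ∈ Δ ∨ ∃ z ∈ N, s ∈ minusTimes G Δ y (minusTimes G Δ x R y) z := by
  refine ((mem_minusSet_succ hxy.ne').1 hs).imp id ?_
  rintro ⟨y₁, y₂, hne, h₁, h₂, hm₁, hm₂⟩
  obtain ⟨z, hz, hzx, hm⟩ : ∃ z, G.Adj y z ∧ z ≠ x ∧ z ∈ minusSet G Δ x R s := by
    by_cases h : y₁ = x
    · exact ⟨y₂, h₂, fun h' => hne (h.trans h'.symm), hm₂⟩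
    · exact ⟨y₁, h₁, h, hm₁⟩
  refine ⟨z, (hN z).2 ⟨hz, hzx⟩, ?_⟩
  rw [minusTimes_child hG hxy hz hzx]
  exact hm

theorem exists_two_children_of_mem (hG : G.IsAcyclic) (hxy : G.Adj x y)
    (hN : ∀ z, z ∈ N ↔ G.Adj y z ∧ z ≠ x) {s : ℕ} (hs : s + 1 ∈ minusTimes G Δ x R y)
    (hR : s ∉ R) :
    (s + 1, y) ∈ Δ ∨ ∃ z ∈ N, ∃ z' ∈ N, z ≠ z' ∧
      s ∈ minusTimes G Δ y (minusTimes G Δ x R y) z ∧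
      s ∈ minusTimes G Δ y (minusTimes G Δ x R y) z' := by
  refine ((mem_minusSet_succ hxy.ne').1 hs).imp id ?_
  rintro ⟨y₁, y₂, hne, h₁, h₂, hm₁, hm₂⟩
  have hx : ∀ z, z ∈ minusSet G Δ x R s → z ≠ x := by
    rintro z hz rfl
    exact hR (mem_minusSet_self.1 hz)
  refine ⟨y₁, (hN _).2 ⟨h₁, hx _ hm₁⟩, y₂, (hN _).2 ⟨h₂, hx _ hm₂⟩, hne, ?_, ?_⟩
  · rw [minusTimes_child hG hxy h₁ (hx _ hm₁)]
    exact hm₁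
  · rw [minusTimes_child hG hxy h₂ (hx _ hm₂)]
    exact hm₂

theorem notMem_child (hG : G.IsAcyclic) (hxy : G.Adj x y) (hyz : G.Adj y z) (hzx : z ≠ x) {s : ℕ}
    (hs : s + 1 ∉ minusTimes G Δ x R y) (hR : s ∈ R) :
    s ∉ minusTimes G Δ y (minusTimes G Δ x R y) z := by
  rw [minusTimes_child hG hxy hyz hzx]
  exact fun h => hs ((mem_minusSet_succ hxy.ne').2
    (Or.inr ⟨z, x, hzx, hyz, hxy.symm, h, mem_minusSet_self.2 hR⟩))

theorem IsRun.isWindow (hG : G.IsAcyclic) (hxy : G.Adj x y)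
    (hN : ∀ z, z ∈ N ↔ G.Adj y z ∧ z ≠ x)
    (hρ : IsRun (minusTimes G Δ x R y) R B (H + 1) ρ)
    (hB' : ∀ f ∈ B', ∀ r, r + 1 = f → r ∉ minusTimes G Δ x R y) :
    IsWindow N H (runStart ρ) ρ.2 {s | (s, y) ∈ Δ}
      (minusTimes G Δ y (minusTimes G Δ x R y))
      (satisfied G x y B' H Δ (minusTimes G Δ x R y)) := by
  have h1 := hρ.one_le
  have h2 := hρ.two_mul_le (zero_notMem_minusTimes hxy.ne')
  have h3 := hρ.le
  have hwin : ∀ k < ρ.2, runStart ρ + 1 + 2 * k ∈ minusTimes G Δ x R y := by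
    intro k hk
    have := (hρ.mem (ρ.2 - 1 - k) (by omega)).2
    rwa [show ρ.1 - 2 * (ρ.2 - 1 - k) = runStart ρ + 1 + 2 * k by unfold runStart; omega] at this
  have hend : runStart ρ + 2 * ρ.2 = ρ.1 + 1 := by unfold runStart; omega
  refine ⟨by omega, fun k hk => ?_, fun s hs => hs, fun z hz κ hκ l hl hmem hstart hend_run => ?_⟩
  · have htime : runStart ρ + 1 + 2 * k = runStart ρ + 2 * k + 1 := by omega
    rw [htime]
    exact exists_child_of_mem hG hxy hN (htime ▸ hwin k hk)
  · obtain ⟨hyz, hzx⟩ := (hN z).1 hz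
    have hnext := hwin κ hκ
    rw [show runStart ρ + 1 + 2 * κ = runStart ρ + 2 * κ + 1 by omega] at hnext
    refine ⟨(hN z).1 hz, hl, by simp only; omega, hmem, hstart, ?_, fun f hf _ => hB' f hf⟩
    simp only
    rcases hend_run with hlast | hlast
    · rcases hρ.ending with hs | hs
      · left; omega
      · right
        refine ⟨?_, hnext⟩
        -- just after the run of `y` ends, the parent has spin `-1`, so no child has
        rw [show runStart ρ + 2 * κ + 2 = ρ.1 + 1 by omega]
        exact notMem_child hG hxy hyz hzx hs.1 hs.2
    · exact Or.inr ⟨hlast, hnext⟩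

/-- The time just before the start of a run is flagged for the runs of the children. -/
theorem IsRun.notMem_of_succ_eq_runStart {M : Set ℕ} (hρ : IsRun M R B H ρ) {r : ℕ}
    (hr : r + 1 = runStart ρ) : r ∉ M := by
  unfold runStart at hr
  have := hρ.start (by omega)
  rwa [show ρ.1 - 2 * ρ.2 = r by omega] at this

end Step

end Forced

/-! ### The weight of all explanations of given runs -/

section Explanations

variable {V : Type*} {G : SimpleGraph V} {x y : V} {θ ε : ℝ}

open Classical in
/-- The weight of a run `ρ = (q, m)`; it has an extra factor `θ` if the run contains a time in `B`,
where the parent is known not to help. -/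
noncomputable def flaggedWeight (θ : ℝ) (B : Set ℕ) (ρ : ℕ × ℕ) : ℝ :=
  (if ∃ f ∈ B, ∃ i < ρ.2, f + 2 * i = ρ.1 then θ else 1) * runWeight θ ρ.2

theorem flaggedWeight_nonneg (h0 : 0 ≤ θ) (B : Set ℕ) (ρ : ℕ × ℕ) : 0 ≤ flaggedWeight θ B ρ := by
  unfold flaggedWeight
  have := runWeight_nonneg h0 ρ.2
  split_ifs <;> positivity

theorem flaggedWeight_le (h0 : 0 ≤ θ) (h1 : θ ≤ 1) (B : Set ℕ) (ρ : ℕ × ℕ) :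
    flaggedWeight θ B ρ ≤ runWeight θ ρ.2 := by
  unfold flaggedWeight
  have := runWeight_nonneg h0 ρ.2
  split_ifs
  · exact mul_le_of_le_one_left this h1
  · rw [one_mul]

/-- The event that the runs in `I` occur at `y` for some behaviour of the parent `x` is covered by
finite sets of defects behind `y`, and their total weight is at most the product of the weights of
the runs. -/
abbrev RunsCovered (G : SimpleGraph V) (θ ε : ℝ) (H : ℕ) (x y : V) (B : Set ℕ)
    (I : Finset (ℕ × ℕ)) : Prop :=
  IsCovered (fun _ => ε) {p : ℕ × V | p.2 ∈ side G x y}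
    {Δ | ∃ R, ∀ ρ ∈ I, IsRun (minusTimes G Δ x R y) R B H ρ} (∏ ρ ∈ I, flaggedWeight θ B ρ)

/-- The weight of a request. -/
noncomputable def requestWeight (θ ε : ℝ) (B : Set ℕ) : Request V → ℝ :=
  Sum.elim (fun _ => ε) fun c => flaggedWeight θ B c.2

theorem requestWeight_nonneg (h0 : 0 ≤ θ) (hε : 0 ≤ ε) (B : Set ℕ) (c : Request V) :
    0 ≤ requestWeight θ ε B c := by
  rcases c with s | c
  exacts [hε, flaggedWeight_nonneg h0 B _]

theorem isChainWeight_requestWeight {N : Finset V} {p₀ : ℕ} {B : Set ℕ} (h0 : 0 < θ)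
    (hN : 16 * (N.card : ℝ) * θ ≤ 1) (h1 : 16 * θ ≤ 1) (hε0 : 0 ≤ ε) (hε : 10000 * ε ≤ θ ^ 3)
    (hp : p₀ ∈ B) : IsChainWeight N p₀ θ ε (requestWeight θ ε B) where
  pos := h0
  card := hN
  le_one := h1
  eps := hε
  nonneg := requestWeight_nonneg h0.le hε0 B
  inl _ := le_rfl
  inr _ _ _ := flaggedWeight_le h0.le (by linarith) B _
  inr_start z k i := by
    change flaggedWeight θ B _ ≤ _
    unfold flaggedWeight
    rw [if_pos ⟨p₀, hp, k, by simp only; omega, rfl⟩]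

/-- Requests at different children, and defects at the vertex itself, are covered by disjoint sets
of defects, so that their weights multiply. -/
theorem isCovered_satisfied (hG : G.IsAcyclic) (hxy : G.Adj x y) (h0 : 0 ≤ θ) (hε : 0 ≤ ε)
    {H : ℕ} {B : Set ℕ} (ih : ∀ z, G.Adj y z → ∀ I, RunsCovered G θ ε H y z B I)
    (F : Finset (Request V)) :
    IsCovered (fun _ => ε) {p : ℕ × V | p.2 ∈ side G x y}
      {Δ | ∃ M, (F : Set (Request V)) ⊆ satisfied G x y B H Δ M}
      (∏ c ∈ F, requestWeight θ ε B c) := by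
  classical
  by_cases hall : ∀ c ∈ F.toRight, G.Adj y c.1 ∧ c.1 ≠ x
  swap
  · refine IsCovered.of_isEmpty ?_
      (Finset.prod_nonneg fun c _ => requestWeight_nonneg h0 hε B c)
    rintro Δ ⟨M, hM⟩
    refine hall fun c hc => ?_
    have hc' : (Sum.inr c : Request V) ∈ satisfied G x y B H Δ M := hM (Finset.mem_toRight.1 hc)
    exact hc'.1
  set Z := F.toRight.image Prod.fst with hZ
  set I : V → Finset (ℕ × ℕ) := fun z => (F.toRight.filter fun c => c.1 = z).image Prod.snd with hI
  have hmemI : ∀ z ρ, ρ ∈ I z ↔ Sum.inr (z, ρ) ∈ F := by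
    intro z ρ
    simp only [hI, Finset.mem_image, Finset.mem_filter, Finset.mem_toRight]
    constructor
    · rintro ⟨⟨z', ρ'⟩, ⟨h, rfl⟩, rfl⟩
      exact h
    · exact fun h => ⟨(z, ρ), ⟨h, rfl⟩, rfl⟩
  have hZadj : ∀ z ∈ Z, G.Adj y z ∧ z ≠ x := by
    intro z hz
    obtain ⟨c, hc, rfl⟩ := Finset.mem_image.1 hz
    exact hall c hc
  have hnn : ∀ _ : ℕ × V, 0 ≤ ε := fun _ => hε
  have hruns := IsCovered.biInter hnn Z
    (fun z hz => ih z (hZadj z hz).1 (I z)) (fun z hz z' hz' hne => by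
      have := disjoint_side hG (hZadj z hz).1 (hZadj z' hz').1 hne
      exact Disjoint.preimage Prod.snd this)
  have hdef := IsCovered.finset (w := fun _ : ℕ × V => ε) (F.toLeft.image fun s => (s, y))
  refine (hdef.inter hnn hruns ?_).mono ?_ ?_ (le_of_eq ?_)
  · rw [Set.disjoint_iUnion₂_right]
    intro z hz
    rw [Set.disjoint_left]
    intro p hp hp'
    obtain ⟨s, -, rfl⟩ := Finset.mem_image.1 (Finset.mem_coe.1 hp)
    exact notMem_side hG (hZadj z hz).1 hp'
  · refine Set.union_subset ?_ (Set.iUnion₂_subset fun z hz p hp => ?_)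
    · intro p hp
      obtain ⟨s, -, rfl⟩ := Finset.mem_image.1 (Finset.mem_coe.1 hp)
      exact mem_side_self
    · exact side_subset_side hG hxy (hZadj z hz).1 (hZadj z hz).2 hp
  · rintro Δ ⟨M, hM⟩
    refine ⟨?_, fun z hz => ⟨M, fun ρ hρ => ?_⟩⟩
    · intro p hp
      obtain ⟨s, hs, rfl⟩ := Finset.mem_image.1 (Finset.mem_coe.1 hp)
      exact hM (Finset.mem_toLeft.1 hs)
    · have hc : (Sum.inr (z, ρ) : Request V) ∈ satisfied G x y B H Δ M := hM ((hmemI z ρ).1 hρ)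
      exact hc.2
  · rw [Finset.prod_sum_eq_prod_toLeft_mul_prod_toRight]
    congr 1
    · exact Finset.prod_image fun s _ s' _ h => congrArg Prod.fst h
    · refine (Finset.prod_finset_product' F.toRight Z I ?_).symm
      rintro ⟨z, ρ⟩
      rw [hmemI, Finset.mem_toRight]
      exact ⟨fun h => ⟨Finset.mem_image.2 ⟨(z, ρ), Finset.mem_toRight.2 h, rfl⟩, h⟩, fun h => h.2⟩

/-- The chains of requests that explain one run have at most the weight of the run. -/
theorem exists_isCovered_chain {N : Finset V} {B B' : Set ℕ} {H : ℕ} {ρ : ℕ × ℕ} (hm : 1 ≤ ρ.2)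
    (hw : IsChainWeight N (runStart ρ) θ ε (requestWeight θ ε B')) (hG : G.IsAcyclic)
    (hxy : G.Adj x y) (hN : ∀ z, z ∈ N ↔ G.Adj y z ∧ z ≠ x) :
    ∃ A, IsCovered (requestWeight θ ε B') (chainSupport (runStart ρ) ρ.2 true (ρ.2 - 1)) A
        (flaggedWeight θ B ρ) ∧
      ∀ Δ R, IsRun (minusTimes G Δ x R y) R B (H + 1) ρ →
        (∀ f ∈ B', ∀ r, r + 1 = f → r ∉ minusTimes G Δ x R y) →
        satisfied G x y B' H Δ (minusTimes G Δ x R y) ∈ A := by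
  have hr := runWeight_nonneg hw.pos.le ρ.2
  by_cases hflag : ∃ f ∈ B, ∃ i < ρ.2, f + 2 * i = ρ.1
  · obtain ⟨f, hf, i, hi, hfi⟩ := id hflag
    refine ⟨{S | Chain N H (runStart ρ) ρ.2 (ρ.2 - 1 - i) S true (ρ.2 - 1)},
      (hw.isCovered_marked (by omega)).mono subset_rfl subset_rfl (le_of_eq ?_), ?_⟩
    · unfold flaggedWeight chainWeight
      rw [if_pos hflag, if_pos rfl, Nat.sub_add_cancel hm]
    · intro Δ R hρ hB'
      have h2 := hρ.two_mul_le (zero_notMem_minusTimes hxy.ne')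
      have hfM := (hρ.mem i hi).2
      have htime : runStart ρ + 2 * (ρ.2 - 1 - i) + 1 = f := by unfold runStart; omega
      rw [show ρ.1 - 2 * i = runStart ρ + 2 * (ρ.2 - 1 - i) + 1 by omega] at hfM
      -- the parent does not help at the flagged time, so two children are needed
      have h := exists_two_children_of_mem hG hxy hN hfM (hρ.flag f hf ⟨i, hi, hfi⟩ _ htime)
      refine (hρ.isWindow hG hxy hN hB').marked_chain (by omega) ?_ _ (by omega) (by omega)
      rwa [show runStart ρ + 1 + 2 * (ρ.2 - 1 - i) = runStart ρ + 2 * (ρ.2 - 1 - i) + 1 by omega]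
  · refine ⟨{S | ∃ b, Chain N H (runStart ρ) ρ.2 0 S b (ρ.2 - 1)},
      (hw.isCovered_chain_of_marked (by omega) (hw.isCovered_marked (by omega))).mono subset_rfl
        subset_rfl ?_, ?_⟩
    · unfold flaggedWeight
      rw [if_neg hflag, Nat.sub_add_cancel hm]
      linarith
    · intro Δ R hρ hB'
      exact (hρ.isWindow hG hxy hN hB').exists_chain 0 _ (by omega)

/-- The induction over the time horizon: the runs of `y` are explained by chains of requests, and
the requests by the induction hypothesis for the children of `y`. -/
theorem runsCovered (hG : G.IsAcyclic) (h0 : 0 < θ) (h1 : 16 * θ ≤ 1) (hε0 : 0 ≤ ε)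
    (hε : 10000 * ε ≤ θ ^ 3)
    (hN : ∀ x y, ∃ N : Finset V, (∀ z, z ∈ N ↔ G.Adj y z ∧ z ≠ x) ∧ 16 * (N.card : ℝ) * θ ≤ 1)
    (H : ℕ) : ∀ x y, G.Adj x y → ∀ B I, RunsCovered G θ ε H x y B I := by
  induction H with
  | zero =>
    intro x y hxy B I
    rcases I.eq_empty_or_nonempty with rfl | ⟨ρ, hρ⟩
    · exact (IsCovered.one _).mono (Set.empty_subset _) subset_rfl (by simp)
    · refine IsCovered.of_isEmpty ?_ (Finset.prod_nonneg fun ρ _ => flaggedWeight_nonneg h0.le B ρ)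
      rintro Δ ⟨R, hR⟩
      have h2 := (hR ρ hρ).two_mul_le (zero_notMem_minusTimes hxy.ne')
      have h3 := (hR ρ hρ).le
      have h4 := (hR ρ hρ).one_le
      omega
  | succ H ih =>
    intro x y hxy B I
    by_cases hex : ∃ Δ R, ∀ ρ ∈ I, IsRun (minusTimes G Δ x R y) R B (H + 1) ρ
    swap
    · exact IsCovered.of_isEmpty (fun Δ ⟨R, hR⟩ => hex ⟨Δ, R, hR⟩)
        (Finset.prod_nonneg fun ρ _ => flaggedWeight_nonneg h0.le B ρ)
    obtain ⟨Δ₀, R₀, hex⟩ := hex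
    obtain ⟨N, hN, hcard⟩ := hN x y
    set B' : Set ℕ := {f | ∃ ρ ∈ I, f = runStart ρ}
    have hchain : ∀ ρ, ∃ A, ρ ∈ I →
        IsCovered (requestWeight θ ε B') (chainSupport (runStart ρ) ρ.2 true (ρ.2 - 1)) A
          (flaggedWeight θ B ρ) ∧
        ∀ Δ R, IsRun (minusTimes G Δ x R y) R B (H + 1) ρ →
          (∀ f ∈ B', ∀ r, r + 1 = f → r ∉ minusTimes G Δ x R y) →
          satisfied G x y B' H Δ (minusTimes G Δ x R y) ∈ A := by
      intro ρ
      by_cases hρ : ρ ∈ I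
      · obtain ⟨A, hA⟩ := exists_isCovered_chain (B := B) (H := H) (hex ρ hρ).one_le
          (isChainWeight_requestWeight (N := N) h0 hcard h1 hε0 hε
            (show runStart ρ ∈ B' from ⟨ρ, hρ, rfl⟩)) hG hxy hN
        exact ⟨A, fun _ => hA⟩
      · exact ⟨∅, fun h => (hρ h).elim⟩
    choose A hA using hchain
    have hcov := IsCovered.biInter (requestWeight_nonneg (V := V) h0.le hε0 B') I
      (fun ρ hρ => (hA ρ hρ).1) (fun ρ hρ ρ' hρ' hne => (hex ρ hρ).disjoint_chainSupport
        (hex ρ' hρ') (zero_notMem_minusTimes hxy.ne') hne)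
    refine (hcov.bind (fun _ => hε0) (satisfied G x y B' H)
      (isCovered_satisfied hG hxy h0.le hε0 fun z hz => ih y z hz B')).mono subset_rfl ?_ le_rfl
    rintro Δ ⟨R, hR⟩
    refine ⟨minusTimes G Δ x R y, fun ρ hρ => (hA ρ hρ).2 Δ R (hR ρ hρ) ?_⟩
    rintro _ ⟨ρ', hρ', rfl⟩ r hr
    exact (hR ρ' hρ').notMem_of_succ_eq_runStart hr

/-- If `z` has spin `-1` at the time `t`, then a run of `z`, cut at the horizon `t`, ends there. -/
theorem isCovered_mem_minusTimes {t : ℕ} {x z : V} (h0 : 0 ≤ θ) (h1 : θ ≤ 1)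
    (hε : 0 ≤ ε) (h : ∀ I, RunsCovered G θ ε t x z ∅ I) :
    IsCovered (fun _ => ε) {p : ℕ × V | p.2 ∈ side G x z}
      {Δ | t ∈ minusTimes G Δ x Set.univ z} (2 * runWeight θ 1) := by
  refine (IsCovered.biUnion (fun _ => hε) (Finset.range (t + 1)) (fun i _ => h {(t, 1 + i)})).mono
    subset_rfl ?_ ?_
  · intro Δ hΔ
    obtain ⟨L, hL, hmem, hstart⟩ := exists_backward_run hΔ
    have := (hmem (L - 1) (by omega)).1
    refine ⟨L - 1, Finset.mem_range.2 (by omega), Set.univ, fun ρ hρ => ?_⟩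
    rw [Finset.mem_singleton] at hρ
    subst hρ
    rw [show 1 + (L - 1) = L by omega]
    exact ⟨hL, le_rfl, hmem, hstart, Or.inl rfl, by simp⟩
  · refine le_trans (Finset.sum_le_sum fun i _ => ?_) (sum_runWeight_add_le h0 h1 le_rfl t)
    rw [Finset.prod_singleton]
    exact flaggedWeight_le h0 h1 _ _

/-- The event that `v` has spin `-1` is covered by sets of defects with a small total weight. -/
theorem isCovered_minus (hG : G.IsAcyclic) (h0 : 0 < θ) (h1 : 16 * θ ≤ 1) (hε0 : 0 ≤ ε)
    (hε : 10000 * ε ≤ θ ^ 3) {N : V → Finset V} (hN : ∀ y z, z ∈ N y ↔ G.Adj y z)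
    (hcard : ∀ y, 16 * ((N y).card : ℝ) * θ ≤ 1) (v : V) (t : ℕ) :
    IsCovered (fun _ => ε) Set.univ
      {Δ : Set (ℕ × V) | (t + 1, v) ∈ Δ ∨ ∃ z ∈ N v, t ∈ minusTimes G Δ v Set.univ z} (1 / 4) := by
  classical
  have hruns := runsCovered hG h0 h1 hε0 hε (fun x y => ⟨(N y).erase x, fun z => by
    rw [Finset.mem_erase, hN, and_comm], by
      refine le_trans ?_ (hcard y)
      have : (((N y).erase x).card : ℝ) ≤ (N y).card := by
        exact_mod_cast Finset.card_le_card (Finset.erase_subset _ _)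
      nlinarith⟩) t
  refine ((IsCovered.mem (c := (t + 1, v)) (Set.mem_univ _) le_rfl).union (fun _ => hε0)
    (IsCovered.biUnion (fun _ => hε0) (N v) fun z hz => (isCovered_mem_minusTimes
      h0.le (by linarith) hε0 (hruns v z ((hN v z).1 hz) ∅)).mono (Set.subset_univ _)
      subset_rfl le_rfl)).mono subset_rfl subset_rfl ?_
  rw [Finset.sum_const, nsmul_eq_mul]
  have h : runWeight θ 1 = θ * (θ / 100) := by
    unfold runWeight
    norm_num
  have hc := mul_le_mul_of_nonneg_right (hcard v) h0.le
  have h3 : θ ^ 3 ≤ 1 := pow_le_one₀ h0.le (by linarith)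
  rw [h]
  nlinarith

end Explanations

/-! ### From covers to probabilities -/

/-- The pairs (time, vertex) with a noise update to `-1`. -/
def defects {V : Type*} (ω : ℕ × V → Update) : Set (ℕ × V) := {p | ω p = Update.noise Spin.minus}

theorem updateLaw_noise_minus_le (ε : Set.Ioo (0 : ℝ) 1) :
    updateLaw ε {Update.noise Spin.minus} ≤ ENNReal.ofReal ε := by
  have h0 : (0 : ℝ) < ε := ε.2.1
  have hm : MeasurableSet ({Update.noise Spin.minus} : Set Update) := trivial
  simp only [updateLaw, Measure.add_apply, Measure.smul_apply, Measure.dirac_apply' _ hm,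
    smul_eq_mul]
  simp only [Set.indicator, Set.mem_singleton_iff, reduceCtorEq, if_false, Update.noise.injEq,
    if_true, mul_zero, zero_add, add_zero, Pi.one_apply, mul_one]
  exact ENNReal.ofReal_le_ofReal (by linarith)

theorem updateMeasure_subset_defects_le {V : Type*} (ε : Set.Ioo (0 : ℝ) 1)
    (F : Finset (ℕ × V)) :
    (updateMeasure V ε).real {ω | (F : Set (ℕ × V)) ⊆ defects ω} ≤ ∏ _p ∈ F, (ε : ℝ) := by
  have hset : {ω : ℕ × V → Update | (F : Set (ℕ × V)) ⊆ defects ω}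
      = Set.pi F fun _ => {Update.noise Spin.minus} := rfl
  have h0 : (0 : ℝ) ≤ ε := ε.2.1.le
  refine ENNReal.toReal_le_of_le_ofReal (Finset.prod_nonneg fun _ _ => h0) ?_
  have hm : ∀ p ∈ F, MeasurableSet ({Update.noise Spin.minus} : Set Update) := fun _ _ => trivial
  rw [hset, updateMeasure, Measure.infinitePi_pi _ hm,
    ENNReal.ofReal_prod_of_nonneg fun _ _ => h0]
  exact Finset.prod_le_prod' fun _ _ => updateLaw_noise_minus_le ε

theorem IsCovered.measure_le {V : Type*} {ε : Set.Ioo (0 : ℝ) 1} {U : Set (ℕ × V)}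
    {A : Set (Set (ℕ × V))} {β : ℝ} (h : IsCovered (fun _ => (ε : ℝ)) U A β) :
    (updateMeasure V ε).real {ω | defects ω ∈ A} ≤ β := by
  obtain ⟨𝓕, -, h2, h3⟩ := h
  calc (updateMeasure V ε).real {ω | defects ω ∈ A}
      ≤ (updateMeasure V ε).real (⋃ F ∈ 𝓕, {ω | (F : Set (ℕ × V)) ⊆ defects ω}) := by
        refine measureReal_mono (fun ω hω => ?_) (measure_ne_top _ _)
        obtain ⟨F, hF, hFω⟩ := h3 _ hω
        exact Set.mem_iUnion₂.2 ⟨F, hF, hFω⟩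
    _ ≤ ∑ F ∈ 𝓕, (updateMeasure V ε).real {ω | (F : Set (ℕ × V)) ⊆ defects ω} :=
        measureReal_biUnion_finset_le _ _
    _ ≤ ∑ F ∈ 𝓕, ∏ _p ∈ F, (ε : ℝ) :=
        Finset.sum_le_sum fun F _ => updateMeasure_subset_defects_le ε F
    _ ≤ β := h2

section Domination

variable {V : Type*} {G : SimpleGraph V} {ω : ℕ × V → Update}

theorem exists_of_minusBiasedVote_succ {t : ℕ} {u : V}
    (h : minusBiasedVote G ω (t + 1) u = Spin.minus) : (t + 1, u) ∈ defects ω ∨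
      ∃ y₁ y₂, y₁ ≠ y₂ ∧ G.Adj u y₁ ∧ G.Adj u y₂ ∧ minusBiasedVote G ω t y₁ = Spin.minus ∧
        minusBiasedVote G ω t y₂ = Spin.minus := by
  change applyUpdate G (minusBiasedVote G ω t) u (ω (t + 1, u)) = Spin.minus at h
  rcases hω : ω (t + 1, u) with - | s
  · rw [hω] at h
    unfold applyUpdate at h
    split_ifs at h with hcard
    obtain ⟨y₁, h₁, y₂, h₂, hne⟩ := Set.one_lt_encard_iff_nontrivial.1
      (lt_of_lt_of_le (by norm_num) hcard)
    exact Or.inr ⟨y₁, y₂, hne, h₁.1, h₂.1, h₁.2, h₂.2⟩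
  · rw [hω] at h
    change s = Spin.minus at h
    subst h
    exact Or.inl hω

/-- The process is dominated by the one in which `v` always has spin `-1`. -/
theorem mem_minusSet_of_minusBiasedVote (v : V) {t : ℕ} {u : V}
    (h : minusBiasedVote G ω t u = Spin.minus) :
    u ∈ minusSet G (defects ω) v Set.univ t := by
  induction t generalizing u with
  | zero => simp [minusBiasedVote] at h
  | succ t ih =>
    by_cases huv : u = v
    · subst huv
      exact mem_minusSet_self.2 (Set.mem_univ _)
    · rw [mem_minusSet_succ huv]
      refine (exists_of_minusBiasedVote_succ h).imp id ?_
      rintro ⟨y₁, y₂, hne, h₁, h₂, hm₁, hm₂⟩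
      exact ⟨y₁, y₂, hne, h₁, h₂, ih hm₁, ih hm₂⟩

end Domination

theorem theorem1p3 (d : ℕ) (hd : 3 ≤ d) :
    ∃ ε₀ : ℝ, 0 < ε₀ ∧ ∃ c : ℝ, 0 < c ∧ c < 1 / 2 ∧
      ∀ (V : Type*) [Infinite V] (T : SimpleGraph V), T.IsTree →
        (∀ v : V, (T.neighborSet v).encard ≤ d) →
        ∀ ε : Set.Ioo (0 : ℝ) 1, (ε : ℝ) < ε₀ →
          ∀ (v : V) (t : ℕ),
            (updateMeasure V ε).real {ω | minusBiasedVote T ω t v = Spin.minus} ≤ c := by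
  have hd0 : (3 : ℝ) ≤ d := by exact_mod_cast hd
  -- `θ` beats the choice among at most `d` neighbours, with room for the constants of the induction
  set θ : ℝ := 1 / (16 * d) with hθ
  have hθ0 : 0 < θ := by positivity
  have hdθ : 16 * (d : ℝ) * θ = 1 := by rw [hθ]; field_simp
  have hθ1 : 16 * θ ≤ 1 := by nlinarith
  refine ⟨θ ^ 3 / 10000, by positivity, 1 / 4, by norm_num, by norm_num, ?_⟩
  intro V _ T hT hdeg ε hε v t
  have hfin : ∀ y, (T.neighborSet y).Finite := fun y => Set.finite_of_encard_le_coe (hdeg y)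
  have hcard : ∀ y, 16 * ((hfin y).toFinset.card : ℝ) * θ ≤ 1 := by
    intro y
    have h := hdeg y
    rw [(hfin y).encard_eq_coe_toFinset_card] at h
    have h' : ((hfin y).toFinset.card : ℝ) ≤ d := by exact_mod_cast h
    nlinarith
  rcases t with - | t
  · have : {ω : ℕ × V → Update | minusBiasedVote T ω 0 v = Spin.minus} = ∅ := by
      simp [minusBiasedVote]
    rw [this, measureReal_empty]
    norm_num
  · refine le_trans (measureReal_mono fun ω hω => ?_) (isCovered_minus hT.isAcyclic hθ0 hθ1
      ε.2.1.le (by linarith) (N := fun y => (hfin y).toFinset)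
      (fun y z => by simp) hcard v t).measure_le
    refine (exists_of_minusBiasedVote_succ hω).imp id ?_
    rintro ⟨z, -, -, hz, -, hm, -⟩
    exact ⟨z, by simpa using hz, mem_minusSet_of_minusBiasedVote v hm⟩
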